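/- **Setting.** Let $n\ge 1$ and let $\Gamma\subseteq\mathbb R^n$ be a closed subgroup spanning $\mathbb R^n$ (all of $\mathbb R^n$, a lattice, ...) with Haar measure $dx$. Let $\mathfrak A$ be a unital C*-algebra with strongly continuous actions by *-automorphisms of the space translations, $x\mapsto\tau_x$ ($x\in\Gamma$; write $B(x)=\tau_x(B)$), and of the time evolution, $t\mapsto\alpha_t$ ($t\in\mathbb R$), which commute. Let $V\mapsto\mathfrak A(V)$ be a translation covariant, isotonous net of unital *-subalgebras such that algebras of disjoint regions commute and the local algebra $\mathfrak A_0=\bigcup_{V\text{ bounded}}\mathfrak A(V)$ is dense in $\mathfrak A$. Let $\langle\cdot\rangle=\omega$ be a translation invariant KMS state for $\alpha$ at inverse temperature $\beta>0$. Let $q=q^*\in\mathfrak A_0$ and let $f\ge 0$ be a smooth function with $f(s)=1$ for $s\le1$ and $f(s)=0$ for $s\ge2$. Put $$Q_R=\int q(x)\,f(|x|/R)\,dx,\qquad A_R=\int_{|x|\le R}A(x)\,dx,\qquad V_R=\int_{|x|\le R}dx ,$$ and write $[H,B]=-i\,\frac{d}{dt}\alpha_t(B)\big|_{t=0}$ whenever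 this derivative exists. Assume: * (short range) $\dot q=\frac{d}{dt}\alpha_t(q)|_{t=0}$ exists and $\int(1+|x|^2)\,\|[q(x),\dot q]\|\,dx<\infty$ (for example, $\dot q\in\mathfrak A_0$); * (symmetry) there is a strongly continuous one-parameter group $\sigma_s$ of *-automorphisms of $\mathfrak A$ which commutes with the time evolution and is generated by $q$: $\frac{d}{ds}\sigma_s(B)|_{s=0}=\lim_{R\to\infty}i[Q_R,B]$ in norm for all $B\in\mathfrak A_0$ and for $B=\dot q$; * (spontaneous breaking) $A=A^*\in\mathfrak A$ satisfies $\langle A\rangle=0$, is local (or, more generally, satisfies $\int\|[q(x),A]\|\,dx<\infty$), and $\lim_{R\to\infty}\langle[Q_R,A]\rangle$ exists and is nonzero. **Theorem.** Then: 1. For every $R>0$ the derivative defining $[H,Q_R]$ exists, and the Bogoliubov inequality holds: $$|\langle[Q_R,V_R^{-1}A_R]\rangle|^2\le\beta\,\langle V_R^{-1}A_R\,V_R^{-1}A_R\rangle\,\langle[Q_R,[H,Q_R]]\rangle .$$ 2. $\langle[Q_R,[H,Q_R]]\rangle=O(R^{n-2})$ as $R\to\infty$. 3. The fluctuations of the symmetry-breaking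 observable are anomalously large: there is $c>0$ such that $\langle A_RA_R\rangle\ge c\,R^{n+2}$ for all sufficiently large $R$. 4. The two-point function decays no faster than $|x|^{2-n}$: there is $c>0$ such that $|\langle A(x)A\rangle|\ge c\,|x|^{2-n}$ for points $x\in\Gamma$ of arbitrarily large norm. -/

import Mathlib

open MeasureTheory Filter Topology Asymptotics
open scoped Pointwise

/-- A strongly continuous action of a topological group `G` on a C*-algebra by star automorphisms.
It is used for the space translations, for the time evolution and for one-parameter symmetry
groups. -/
structure StarAction (G 𝔄 : Type*) [AddGroup G] [TopologicalSpace G] [CStarAlgebra 𝔄] where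
  act : G → (𝔄 ≃⋆ₐ[ℂ] 𝔄)
  act_zero : ∀ B : 𝔄, act 0 B = B
  act_add : ∀ (g h : G) (B : 𝔄), act (g + h) B = act g (act h B)
  continuous_orbit : ∀ B : 𝔄, Continuous fun g : G => act g B

instance {G 𝔄 : Type*} [AddGroup G] [TopologicalSpace G] [CStarAlgebra 𝔄] :
    CoeFun (StarAction G 𝔄) (fun _ => G → (𝔄 ≃⋆ₐ[ℂ] 𝔄)) where
  coe := StarAction.act

/-- Two actions on the same algebra commute. -/
def StarAction.Commutes {G H 𝔄 : Type*} [AddGroup G] [TopologicalSpace G] [AddGroup H]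
    [TopologicalSpace H] [CStarAlgebra 𝔄] (α : StarAction G 𝔄) (γ : StarAction H 𝔄) : Prop :=
  ∀ (g : G) (h : H) (B : 𝔄), α g (γ h B) = γ h (α g B)

/-- A translation covariant net of local algebras `loc V`, `V ⊆ ℝⁿ`: isotony, commutativity for
disjoint regions, covariance, and density of the local algebra (the union over all bounded
regions), so that the whole algebra is the quasi-local one. -/
structure LocalNet {n : ℕ} {Γ : AddSubgroup (EuclideanSpace ℝ (Fin n))} {𝔄 : Type*}
    [CStarAlgebra 𝔄] (τ : StarAction Γ 𝔄) where
  loc : Set (EuclideanSpace ℝ (Fin n)) → StarSubalgebra ℂ 𝔄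
  mono : ∀ V W, V ⊆ W → loc V ≤ loc W
  commute : ∀ V W, Disjoint V W → ∀ B ∈ loc V, ∀ C ∈ loc W, Commute B C
  covariant : ∀ (x : Γ) (V) (B : 𝔄), B ∈ loc V → τ x B ∈ loc ((x : EuclideanSpace ℝ (Fin n)) +ᵥ V)
  dense : Dense {B : 𝔄 | ∃ V, Bornology.IsBounded V ∧ B ∈ loc V}

/-- The local algebra `𝔄₀`: observables localized in some bounded region. -/
def LocalNet.localAlg {n : ℕ} {Γ : AddSubgroup (EuclideanSpace ℝ (Fin n))} {𝔄 : Type*}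
    [CStarAlgebra 𝔄] {τ : StarAction Γ 𝔄} (N : LocalNet τ) : Set 𝔄 :=
  {B : 𝔄 | ∃ V, Bornology.IsBounded V ∧ B ∈ N.loc V}

/-- A state: a normalized positive linear functional. -/
structure IsState {𝔄 : Type*} [CStarAlgebra 𝔄] (ω : 𝔄 →L[ℂ] ℂ) : Prop where
  map_one : ω 1 = 1
  nonneg : ∀ B : 𝔄, 0 ≤ (ω (star B * B)).re ∧ (ω (star B * B)).im = 0

/-- `ω` is a KMS state at inverse temperature `β` for the time evolution `α`: it is stationary and,
for all `B, C`, there is a bounded function on the closed strip `0 ≤ Im z ≤ β`, continuous there and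
holomorphic inside, with boundary values `ω(B α_t(C))` at `t` and `ω(α_t(C) B)` at `t + iβ`. -/
structure IsKMS {𝔄 : Type*} [CStarAlgebra 𝔄] (α : StarAction ℝ 𝔄) (β : ℝ) (ω : 𝔄 →L[ℂ] ℂ) :
    Prop where
  isState : IsState ω
  stationary : ∀ (t : ℝ) (B : 𝔄), ω (α t B) = ω B
  kms : ∀ B C : 𝔄, ∃ F : ℂ → ℂ,
    DiffContOnCl ℂ F {z : ℂ | 0 < z.im ∧ z.im < β} ∧
    (∃ M : ℝ, ∀ z : ℂ, 0 ≤ z.im → z.im ≤ β → ‖F z‖ ≤ M) ∧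
    ∀ t : ℝ, F (t : ℂ) = ω (B * α t C) ∧ F (t + β * Complex.I) = ω (α t C * B)

/-- The profile of the smooth volume cut-off `f_R(x) = f(|x|/R)`. -/
structure IsCutoff (f : ℝ → ℝ) : Prop where
  smooth : ContDiff ℝ ((⊤ : ℕ∞) : WithTop ℕ∞) f
  nonneg : ∀ s, 0 ≤ f s
  eq_one : ∀ s, s ≤ 1 → f s = 1
  eq_zero : ∀ s, 2 ≤ s → f s = 0

section Observables

variable {n : ℕ} {Γ : AddSubgroup (EuclideanSpace ℝ (Fin n))} {𝔄 : Type*} [CStarAlgebra 𝔄]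

/-- The smooth local charge `Q_R = ∫ q(x) f(|x|/R) dx`, where `q(x) = τ_x(q)`. -/
noncomputable def charge (τ : StarAction Γ 𝔄) (μ : Measure Γ) (f : ℝ → ℝ) (q : 𝔄) (R : ℝ) : 𝔄 :=
  ∫ x : Γ, ((f (‖x‖ / R) : ℝ) : ℂ) • τ x q ∂μ

/-- The volume `V_R` of the ball of radius `R` about the origin. -/
noncomputable def ballVolume (μ : Measure Γ) (R : ℝ) : ℝ :=
  μ.real {x : Γ | ‖x‖ ≤ R}

/-- The volume integral `A_R = ∫_{|x| ≤ R} A(x) dx`, where `A(x) = τ_x(A)`. -/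
noncomputable def bulk (τ : StarAction Γ 𝔄) (μ : Measure Γ) (A : 𝔄) (R : ℝ) : 𝔄 :=
  ∫ x in {x : Γ | ‖x‖ ≤ R}, τ x A ∂μ

/-- The spatial mean `V_R⁻¹ A_R`. -/
noncomputable def bulkMean (τ : StarAction Γ 𝔄) (μ : Measure Γ) (A : 𝔄) (R : ℝ) : 𝔄 :=
  (((ballVolume μ R)⁻¹ : ℝ) : ℂ) • bulk τ μ A R

/-- The commutator `[H, B]` with the Hamiltonian of the time evolution, `d/dt α_t(B) = i [H, α_t(B)]`,
for an observable `B` along whose orbit the time evolution is differentiable. -/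
noncomputable def hamiltonianComm (α : StarAction ℝ 𝔄) (B : 𝔄) : 𝔄 :=
  (-Complex.I) • deriv (fun t : ℝ => α t B) 0

/-- On the observable `B` the one-parameter group `σ` is generated by the density `q`:
`d/ds σ_s(B)` at `s = 0` is `lim_R i [Q_R, B]`. -/
def GeneratedBy (σ : StarAction ℝ 𝔄) (τ : StarAction Γ 𝔄) (μ : Measure Γ) (f : ℝ → ℝ) (q B : 𝔄) :
    Prop :=
  ∃ D : 𝔄, HasDerivAt (fun s : ℝ => σ s B) D 0 ∧
    Tendsto (fun R : ℝ => Complex.I • ⁅charge τ μ f q R, B⁆) atTop (𝓝 D)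

/-- `A` is a symmetry-breaking observable in the state `ω`: `lim_R ω([Q_R, A])` exists and is
nonzero. -/
def BreaksSymmetry (ω : 𝔄 →L[ℂ] ℂ) (τ : StarAction Γ 𝔄) (μ : Measure Γ) (f : ℝ → ℝ) (q A : 𝔄) :
    Prop :=
  ∃ c : ℂ, c ≠ 0 ∧ Tendsto (fun R : ℝ => ω ⁅charge τ μ f q R, A⁆) atTop (𝓝 c)

end Observables

/-! The KMS condition attaches to a pair `B*`, `C` a function `F` on the strip, and the Duhamel form
(B, C) = ∫₀^β F(is) ds is positive semidefinite. For selfadjoint `A`, `Q` with time derivative `Q'`,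
integrating along the segment from 0 to iβ gives ω([Q, A]) = i (A, Q') and ω([Q, [H, Q]]) = (Q',
Q'), while the maximum principle gives (A, A) ≤ β ω(A²). Cauchy-Schwarz for the form is then
Bogoliubov's inequality (`IsKMS.bogoliubov`). Positivity is obtained without spectral theory: ω(X*X)
≥ 0 for Gaussian averages `X` of the orbit, followed by a contour shift and a limit of narrow
Gaussians (`IsKMS.gaussian_nonneg`, `IsStripFunction.nonneg_of_gaussian`).

For charges the double commutator is, up to the factor -i, the double integral of f_R(x) f_R(y) g(x
- y) with g(x) = ω([q(x), dq]). Because the symmetry commutes with time, g has vanishing integral,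
so f_R(x) f_R(y) may be replaced by -½ (f_R(x) - f_R(y))². This is O(|x - y|²/R²), on a region of
volume R^n, whence R^(n-2) (`IsCutoff.norm_double_integral_le`).

The commutator of the charge with the spatial mean of `A` tends to the nonzero breaking constant, so
Bogoliubov forces ω(A_R A_R) ≥ const · V_R² / R^(n-2), of order R^(n+2). Finally ω(A_R A_R) is at
most V_R times the integral of |ω(A(x) A)| over the ball of radius 2R. That integral therefore grows
like R², which a dyadic summation excludes if the decay is faster than |x|^(2-n)
(`exists_slow_decay`). -/

open scoped ComplexOrder in
theorem Complex.nonneg_of_ofReal_mul_nonneg {r : ℝ} (hr : 0 < r) {z : ℂ} (h : 0 ≤ (r : ℂ) * z) :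
    0 ≤ z := by
  rw [Complex.nonneg_iff, Complex.re_ofReal_mul, Complex.im_ofReal_mul] at h
  rw [Complex.nonneg_iff]
  exact ⟨(mul_nonneg_iff_of_pos_left hr).1 h.1,
    ((mul_eq_zero.1 h.2.symm).resolve_left hr.ne').symm⟩

/-! ### Bounded holomorphic functions on a strip. -/

/-- A bounded continuous function on the closed strip `0 ≤ Im z ≤ β`, holomorphic inside. -/
structure IsStripFunction (β : ℝ) (F : ℂ → ℂ) : Prop where
  diffContOnCl : DiffContOnCl ℂ F {z : ℂ | 0 < z.im ∧ z.im < β}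
  bounded : ∃ M : ℝ, ∀ z : ℂ, 0 ≤ z.im → z.im ≤ β → ‖F z‖ ≤ M

namespace IsStripFunction

variable {β : ℝ} {F G : ℂ → ℂ}

theorem add (hF : IsStripFunction β F) (hG : IsStripFunction β G) :
    IsStripFunction β (F + G) := by
  obtain ⟨M, hM⟩ := hF.bounded
  obtain ⟨M', hM'⟩ := hG.bounded
  exact ⟨hF.diffContOnCl.add hG.diffContOnCl, M + M', fun z h0 h1 =>
    (norm_add_le _ _).trans (add_le_add (hM z h0 h1) (hM' z h0 h1))⟩

theorem const_smul (c : ℂ) (hF : IsStripFunction β F) : IsStripFunction β (c • F) := by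
  obtain ⟨M, hM⟩ := hF.bounded
  refine ⟨hF.diffContOnCl.const_smul c, ‖c‖ * M, fun z h0 h1 => ?_⟩
  rw [Pi.smul_apply, norm_smul]
  exact mul_le_mul_of_nonneg_left (hM z h0 h1) (norm_nonneg _)

theorem comp_add_ofReal (h : ℝ) (hF : IsStripFunction β F) :
    IsStripFunction β (fun z => F (z + h)) := by
  obtain ⟨M, hM⟩ := hF.bounded
  refine ⟨hF.diffContOnCl.comp (differentiable_id.add_const (h : ℂ)).diffContOnCl ?_, M,
    fun z h0 h1 => hM _ (by simpa using h0) (by simpa using h1)⟩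
  intro z hz
  simpa using hz

theorem norm_le (hβ : 0 < β) (hF : IsStripFunction β F) {C : ℝ} (h0 : ∀ t : ℝ, ‖F t‖ ≤ C)
    (h1 : ∀ t : ℝ, ‖F (t + β * Complex.I)‖ ≤ C) {z : ℂ} (hz : 0 ≤ z.im) (hz' : z.im ≤ β) :
    ‖F z‖ ≤ C := by
  obtain ⟨M, hM⟩ := hF.bounded
  -- Boundedness is the growth condition with both exponential rates equal to 0.
  refine PhragmenLindelof.horizontal_strip (a := 0) (b := β) hF.diffContOnCl
    ⟨0, div_pos Real.pi_pos (by simpa using hβ), 0, ?_⟩ (fun w hw => ?_) (fun w hw => ?_) hz hz'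
  · refine IsBigO.of_bound M ?_
    filter_upwards [mem_inf_of_right (mem_principal_self _)] with w hw
    simpa using hM w hw.1.le hw.2.le
  · have : w = (w.re : ℂ) := by apply Complex.ext <;> simp [hw]
    rw [this]
    exact h0 _
  · have : w = (w.re : ℂ) + β * Complex.I := by apply Complex.ext <;> simp [hw]
    rw [this]
    exact h1 _

theorem continuousOn (hβ : 0 < β) (hF : IsStripFunction β F) :
    ContinuousOn F {z : ℂ | 0 ≤ z.im ∧ z.im ≤ β} := by
  have h := hF.diffContOnCl.continuousOn
  have e : closure {z : ℂ | 0 < z.im ∧ z.im < β} = {z : ℂ | 0 ≤ z.im ∧ z.im ≤ β} := by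
    change closure (Complex.im ⁻¹' Set.Ioo 0 β) = Complex.im ⁻¹' Set.Icc 0 β
    rw [Complex.closure_preimage_im, closure_Ioo hβ.ne]
  rwa [e] at h

theorem continuous_horizontal (hβ : 0 < β) (hF : IsStripFunction β F) {s : ℝ} (hs : 0 ≤ s)
    (hs' : s ≤ β) : Continuous fun u : ℝ => F (u + s * Complex.I) := by
  refine (hF.continuousOn hβ).comp_continuous (by fun_prop) fun u => ?_
  simpa using ⟨hs, hs'⟩

theorem continuousOn_vertical (hβ : 0 < β) (hF : IsStripFunction β F) :
    ContinuousOn (fun s : ℝ => F (s * Complex.I)) (Set.Icc 0 β) := by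
  refine (hF.continuousOn hβ).comp (by fun_prop) fun u hu => ?_
  simpa using hu

theorem norm_gaussian_shift (a x y s : ℝ) :
    ‖Complex.exp (-a * (x + y * Complex.I - s * Complex.I) ^ 2)‖
      = Real.exp (-a * x ^ 2 + a * (y - s) ^ 2) := by
  rw [Complex.norm_exp]
  congr 1
  simp [pow_two]
  ring

theorem integrable_gaussian_mul {a : ℝ} (ha : 0 < a) (s : ℝ) {g : ℝ → ℂ} (hg : Continuous g)
    {M : ℝ} (hM : ∀ u, ‖g u‖ ≤ M) :
    Integrable fun u : ℝ => Complex.exp (-a * (u - s * Complex.I) ^ 2) * g u := by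
  have h1 : Integrable fun u : ℝ => Real.exp (a * s ^ 2) * M * Real.exp (-a * u ^ 2) :=
    (integrable_exp_neg_mul_sq ha).const_mul _
  refine h1.mono' (by fun_prop) (Eventually.of_forall fun u => ?_)
  rw [norm_mul]
  have := norm_gaussian_shift a u 0 s
  simp only [Complex.ofReal_zero, zero_mul, add_zero] at this
  rw [this, Real.exp_add]
  have h3 : a * (0 - s) ^ 2 = a * s ^ 2 := by ring
  rw [h3]
  calc _ ≤ Real.exp (-a * u ^ 2) * Real.exp (a * s ^ 2) * M := by gcongr; exact hM u
    _ = _ := by ring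

/-- Shifting the contour of a Gaussian average. -/
theorem integral_gaussian_shift (hβ : 0 < β) (hF : IsStripFunction β F) {a : ℝ} (ha : 0 < a)
    {s : ℝ} (hs : 0 ≤ s) (hs' : s ≤ β) :
    ∫ u : ℝ, Complex.exp (-a * (u - s * Complex.I) ^ 2) * F u =
      ∫ u : ℝ, Complex.exp (-a * (u : ℂ) ^ 2) * F (u + s * Complex.I) := by
  obtain ⟨M, hM⟩ := hF.bounded
  have hM0 : 0 ≤ M := (norm_nonneg _).trans (hM 0 (by simp) (by simpa using hβ.le))
  set H : ℂ → ℂ := fun z => Complex.exp (-a * (z - s * Complex.I) ^ 2) * F z with hH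
  have hHc : ContinuousOn H {z : ℂ | 0 ≤ z.im ∧ z.im ≤ β} :=
    ContinuousOn.mul (by fun_prop) (hF.continuousOn hβ)
  have hHd : DifferentiableOn ℂ H {z : ℂ | 0 < z.im ∧ z.im < β} :=
    DifferentiableOn.mul (by fun_prop) hF.diffContOnCl.differentiableOn
  have i0 : Integrable fun u : ℝ => H u := by
    refine integrable_gaussian_mul ha s (g := fun u : ℝ => F u) ?_ (M := M) fun u => ?_
    · simpa using hF.continuous_horizontal hβ le_rfl hβ.le
    · exact hM _ (by simp) (by simpa using hβ.le)
  have e1 : ∀ u : ℝ, H (u + s * Complex.I) =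
      Complex.exp (-a * (u : ℂ) ^ 2) * F (u + s * Complex.I) := by
    intro u
    simp [hH]
  have i1 : Integrable fun u : ℝ => H (u + s * Complex.I) := by
    simp_rw [e1]
    have := integrable_gaussian_mul ha 0 (g := fun u : ℝ => F (u + s * Complex.I))
      (hF.continuous_horizontal hβ hs hs') (M := M) fun u =>
        hM _ (by simpa using hs) (by simpa using hs')
    simpa using this
  -- Cauchy's theorem on the rectangle with real parts between -T and T; the vertical sides vanish
  -- like exp(-aT²).
  have rect : ∀ T : ℝ, (∫ x : ℝ in (-T)..T, H x) - (∫ x : ℝ in (-T)..T, H (x + s * Complex.I)) +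
      Complex.I • (∫ y : ℝ in (0)..s, H (T + y * Complex.I)) -
      Complex.I • (∫ y : ℝ in (0)..s, H ((-T : ℝ) + y * Complex.I)) = 0 := by
    intro T
    have := Complex.integral_boundary_rect_eq_zero_of_continuousOn_of_differentiableOn H
      ((-T : ℝ) : ℂ) (T + s * Complex.I) ?_ ?_
    · simpa using this
    · refine hHc.mono fun z hz => ?_
      have := hz.2
      simp only [Complex.ofReal_im, Complex.add_im, Complex.mul_im, Complex.ofReal_re,
        Complex.I_im, mul_one, Complex.I_re, mul_zero, add_zero, zero_add,
        Set.uIcc_of_le hs] at this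
      exact ⟨this.1, this.2.trans hs'⟩
    · refine hHd.mono fun z hz => ?_
      have := hz.2
      simp only [Complex.ofReal_im, Complex.add_im, Complex.mul_im, Complex.ofReal_re,
        Complex.I_im, mul_one, Complex.I_re, mul_zero, add_zero, zero_add, min_eq_left hs,
        max_eq_right hs] at this
      exact ⟨this.1, this.2.trans_le hs'⟩
  have side : ∀ T : ℝ, ‖∫ y : ℝ in (0)..s, H (T + y * Complex.I)‖
      ≤ Real.exp (-a * T ^ 2) * (Real.exp (a * s ^ 2) * M * |s|) := by
    intro T
    have := intervalIntegral.norm_integral_le_of_norm_le_const (a := 0) (b := s)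
      (f := fun y : ℝ => H (T + y * Complex.I)) (C := Real.exp (-a * T ^ 2 + a * s ^ 2) * M) ?_
    · refine this.trans (le_of_eq ?_)
      rw [Real.exp_add, sub_zero]
      ring
    · intro y hy
      rw [Set.uIoc_of_le hs] at hy
      simp only [hH, norm_mul]
      rw [norm_gaussian_shift]
      have h1 : (y - s) ^ 2 ≤ s ^ 2 := by nlinarith [hy.1, hy.2]
      have h2 := hM (T + y * Complex.I) (by simpa using hy.1.le) (by simpa using hy.2.trans hs')
      gcongr
  have exp0 : Tendsto (fun T : ℝ => Real.exp (-a * T ^ 2) * (Real.exp (a * s ^ 2) * M * |s|))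
      atTop (𝓝 0) := by
    have h1 : Tendsto (fun T : ℝ => a * T ^ 2) atTop atTop :=
      (tendsto_pow_atTop two_ne_zero).const_mul_atTop ha
    have h2 := Real.tendsto_exp_neg_atTop_nhds_zero.comp h1
    have h3 := h2.mul_const (Real.exp (a * s ^ 2) * M * |s|)
    simpa [Function.comp_def, neg_mul] using h3
  have s1 := squeeze_zero_norm side exp0
  have s2 : Tendsto (fun T : ℝ => ∫ y : ℝ in (0)..s, H ((-T : ℝ) + y * Complex.I)) atTop (𝓝 0) :=
    squeeze_zero_norm (fun T => by simpa using side (-T)) exp0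
  have l0 := intervalIntegral_tendsto_integral i0 tendsto_neg_atTop_atBot tendsto_id
  have l1 := intervalIntegral_tendsto_integral i1 tendsto_neg_atTop_atBot tendsto_id
  have lim := ((l0.sub l1).add (s1.const_smul Complex.I)).sub (s2.const_smul Complex.I)
  simp only [id, rect, smul_zero, add_zero, sub_zero] at lim
  have := tendsto_nhds_unique lim tendsto_const_nhds
  simp_rw [e1] at this
  exact sub_eq_zero.1 this

open scoped ComplexOrder in
/-- A function on the strip is nonnegative at `i s` if its Gaussian averages about `i s` are. -/
theorem nonneg_of_gaussian (hβ : 0 < β) (hF : IsStripFunction β F) {s : ℝ} (hs : 0 ≤ s)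
    (hs' : s ≤ β)
    (h : ∀ a : ℝ, 0 < a → 0 ≤ ∫ u : ℝ, Complex.exp (-a * (u : ℂ) ^ 2) * F (u + s * Complex.I)) :
    0 ≤ F (s * Complex.I) := by
  obtain ⟨M, hM⟩ := hF.bounded
  have hc := hF.continuous_horizontal hβ hs hs'
  -- With a = (m+1)² and v = (m+1)u the Gaussian weight becomes fixed and the concentration moves
  -- into the argument of `F`, which makes dominated convergence applicable.
  have key : ∀ m : ℕ, 0 ≤ ∫ v : ℝ, Complex.exp (-(v : ℂ) ^ 2) *
      F (((((m : ℝ) + 1)⁻¹ * v : ℝ) : ℂ) + s * Complex.I) := by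
    intro m
    have hm : (0 : ℝ) < (m : ℝ) + 1 := by positivity
    have h1 := h (((m : ℝ) + 1) ^ 2) (by positivity)
    have h2 := Measure.integral_comp_mul_left (fun v : ℝ => Complex.exp (-(v : ℂ) ^ 2) *
      F (((((m : ℝ) + 1)⁻¹ * v : ℝ) : ℂ) + s * Complex.I)) ((m : ℝ) + 1)
    have h3 : ∀ u : ℝ, Complex.exp (-((((m : ℝ) + 1) * u : ℝ) : ℂ) ^ 2) *
        F (((((m : ℝ) + 1)⁻¹ * (((m : ℝ) + 1) * u) : ℝ) : ℂ) + s * Complex.I)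
        = Complex.exp (-((((m : ℝ) + 1) ^ 2 : ℝ) : ℂ) * (u : ℂ) ^ 2) * F (u + s * Complex.I) := by
      intro u
      rw [inv_mul_cancel_left₀ hm.ne']
      congr 2
      push_cast
      ring
    simp_rw [h3] at h2
    rw [h2, abs_of_pos (inv_pos.2 hm), Complex.real_smul] at h1
    exact Complex.nonneg_of_ofReal_mul_nonneg (inv_pos.2 hm) h1
  have gint : Integrable fun v : ℝ => Real.exp (-1 * v ^ 2) * M :=
    (integrable_exp_neg_mul_sq one_pos).mul_const _
  have lim : Tendsto (fun m : ℕ => ∫ v : ℝ, Complex.exp (-(v : ℂ) ^ 2) *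
      F (((((m : ℝ) + 1)⁻¹ * v : ℝ) : ℂ) + s * Complex.I)) atTop
      (𝓝 (∫ v : ℝ, Complex.exp (-(v : ℂ) ^ 2) * F (s * Complex.I))) := by
    refine tendsto_integral_of_dominated_convergence _ (fun m => ?_) gint (fun m => ?_) ?_
    · have : Continuous fun v : ℝ => F (((((m : ℝ) + 1)⁻¹ * v : ℝ) : ℂ) + s * Complex.I) :=
        hc.comp (continuous_const.mul continuous_id)
      exact (Continuous.mul (by fun_prop) this).aestronglyMeasurable
    · refine Eventually.of_forall fun v => ?_
      rw [norm_mul, Complex.norm_exp]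
      have h1 : (-(v : ℂ) ^ 2).re = -1 * v ^ 2 := by simp [pow_two]
      rw [h1]
      gcongr
      exact hM _ (by simpa using hs) (by simpa using hs')
    · refine Eventually.of_forall fun v => Tendsto.const_mul _ ?_
      have h1 : Tendsto (fun m : ℕ => ((m : ℝ) + 1)⁻¹ * v) atTop (𝓝 0) := by
        have := (tendsto_one_div_add_atTop_nhds_zero_nat (𝕜 := ℝ)).mul_const v
        simpa using this
      have := (hc.tendsto 0).comp h1
      simpa [Function.comp_def] using this
  have h5 := ge_of_tendsto' lim key
  rw [integral_mul_const] at h5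
  have h6 : ∫ v : ℝ, Complex.exp (-(v : ℂ) ^ 2) = ((Real.sqrt Real.pi : ℝ) : ℂ) := by
    have := integral_gaussian 1
    rw [div_one] at this
    rw [← this, ← integral_complex_ofReal]
    congr 1 with v
    push_cast
    simp
  rw [h6] at h5
  exact Complex.nonneg_of_ofReal_mul_nonneg (Real.sqrt_pos.2 Real.pi_pos) h5

end IsStripFunction

/-! ### Isometric actions, states and Cauchy-Schwarz. -/

section Actions

variable {G 𝔄 : Type*} [AddGroup G] [TopologicalSpace G] [CStarAlgebra 𝔄]

theorem StarAction.norm_act (α : StarAction G 𝔄) (g : G) (B : 𝔄) : ‖α g B‖ = ‖B‖ :=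
  NonUnitalStarAlgHom.norm_map (α g) (EquivLike.injective (α g)) B

/-- An automorphism of the action as a continuous linear map. -/
noncomputable def StarAction.actL (α : StarAction G 𝔄) (g : G) : 𝔄 →L[ℂ] 𝔄 :=
  LinearMap.mkContinuous
    { toFun := α g
      map_add' := map_add (α g)
      map_smul' := fun c B => map_smul (α g) c B } 1 fun B => by
    simp [StarAction.norm_act]

@[simp]
theorem StarAction.actL_apply (α : StarAction G 𝔄) (g : G) (B : 𝔄) : α.actL g B = α g B := rfl

end Actions

/-- A form which is nonnegative on all combinations of two vectors is hermitian on them and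
satisfies the Cauchy-Schwarz inequality; `a`, `b`, `x`, `y` are its matrix elements. -/
theorem cauchySchwarz_of_nonneg {a b : ℝ} (ha : 0 ≤ a) (hb : 0 ≤ b) {x y : ℂ}
    (h : ∀ c : ℂ, 0 ≤ (a + c * x + star c * y + star c * c * b : ℂ).re ∧
      (a + c * x + star c * y + star c * c * b : ℂ).im = 0) :
    y = star x ∧ ‖x‖ ^ 2 ≤ a * b := by
  have hy : y = star x := by
    -- Reality of the form at c = 1 and c = i determines the imaginary and real parts of `y`.
    have h1 := (h 1).2
    have h2 := (h Complex.I).2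
    simp at h1 h2
    apply Complex.ext
    · simp; linarith
    · simp; linarith
  refine ⟨hy, ?_⟩
  -- Taking c = r·star x leaves a real quadratic in r; its discriminant carries a spare factor ‖x‖²,
  -- divided out at the end.
  have h3 : ∀ r : ℝ, 0 ≤ (‖x‖ ^ 2 * b) * (r * r) + 2 * ‖x‖ ^ 2 * r + a := by
    intro r
    have h4 := (h (r * star x)).1
    have h5 : (a + (r * star x) * x + star (r * star x) * y +
          star (r * star x) * (r * star x) * b : ℂ)
        = (((‖x‖ ^ 2 * b) * (r * r) + 2 * ‖x‖ ^ 2 * r + a : ℝ) : ℂ) := by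
      have e : x * star x = ((‖x‖ ^ 2 : ℝ) : ℂ) := by
        rw [Complex.star_def, Complex.mul_conj, Complex.normSq_eq_norm_sq]
      rw [hy]
      simp only [star_mul', star_star]
      have e2 : star (r : ℂ) = r := Complex.conj_ofReal r
      rw [e2]
      push_cast at e ⊢
      linear_combination (2 * (r : ℂ) + r * r * b) * e
    rwa [h5, Complex.ofReal_re] at h4
  have h6 := discrim_le_zero h3
  rw [discrim] at h6
  rcases eq_or_ne (‖x‖ ^ 2) 0 with h7 | h7
  · rw [h7]; positivity
  · have h8 : 0 < ‖x‖ ^ 2 := lt_of_le_of_ne (by positivity) h7.symm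
    nlinarith

section States

variable {𝔄 : Type*} [CStarAlgebra 𝔄] {ω : 𝔄 →L[ℂ] ℂ}

theorem IsState.cauchySchwarz (hω : IsState ω) (B C : 𝔄) :
    ω (star C * B) = star (ω (star B * C)) ∧
      ‖ω (star B * C)‖ ^ 2 ≤ (ω (star B * B)).re * (ω (star C * C)).re := by
  have re : ∀ D : 𝔄, (((ω (star D * D)).re : ℝ) : ℂ) = ω (star D * D) := fun D =>
    Complex.ext (by simp) (by simp [(hω.nonneg D).2])
  refine cauchySchwarz_of_nonneg (hω.nonneg B).1 (hω.nonneg C).1 fun c => ?_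
  have := hω.nonneg (B + c • C)
  have e : ω (star (B + c • C) * (B + c • C)) = ((ω (star B * B)).re : ℂ) + c * ω (star B * C) +
      star c * ω (star C * B) + star c * c * ((ω (star C * C)).re : ℂ) := by
    rw [re, re]
    simp only [star_add, star_smul, add_mul, mul_add, smul_mul_assoc, mul_smul_comm, map_add,
      map_smul, smul_eq_mul]
    ring
  rwa [e] at this

theorem IsState.map_star (hω : IsState ω) (B : 𝔄) : ω (star B) = star (ω B) := by
  simpa using (hω.cauchySchwarz 1 B).1

end States

/-! ### Calculus of KMS functions. -/

section KMS

variable {𝔄 : Type*} [CStarAlgebra 𝔄]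

/-- The function on the strip which the KMS condition assigns to the pair `B, C`. -/
structure IsKMSFunction (α : StarAction ℝ 𝔄) (β : ℝ) (ω : 𝔄 →L[ℂ] ℂ) (B C : 𝔄) (F : ℂ → ℂ) :
    Prop where
  strip : IsStripFunction β F
  lower : ∀ t : ℝ, F t = ω (B * α t C)
  upper : ∀ t : ℝ, F (t + β * Complex.I) = ω (α t C * B)

variable {α : StarAction ℝ 𝔄} {β : ℝ} {ω : 𝔄 →L[ℂ] ℂ}

theorem IsKMS.exists_isKMSFunction (hω : IsKMS α β ω) (B C : 𝔄) :
    ∃ F, IsKMSFunction α β ω B C F := by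
  obtain ⟨F, h1, h2, h3⟩ := hω.kms B C
  exact ⟨F, ⟨h1, h2⟩, fun t => (h3 t).1, fun t => (h3 t).2⟩

namespace IsKMSFunction

variable {B B' C C' : 𝔄} {F G : ℂ → ℂ}

theorem add_right (hF : IsKMSFunction α β ω B C F) (hG : IsKMSFunction α β ω B C' G) :
    IsKMSFunction α β ω B (C + C') (F + G) :=
  ⟨hF.strip.add hG.strip, fun t => by simp [hF.lower, hG.lower, mul_add],
    fun t => by simp [hF.upper, hG.upper, add_mul]⟩

theorem add_left (hF : IsKMSFunction α β ω B C F) (hG : IsKMSFunction α β ω B' C G) :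
    IsKMSFunction α β ω (B + B') C (F + G) :=
  ⟨hF.strip.add hG.strip, fun t => by simp [hF.lower, hG.lower, add_mul],
    fun t => by simp [hF.upper, hG.upper, mul_add]⟩

theorem smul_right (c : ℂ) (hF : IsKMSFunction α β ω B C F) :
    IsKMSFunction α β ω B (c • C) (c • F) :=
  ⟨hF.strip.const_smul c, fun t => by simp [hF.lower], fun t => by simp [hF.upper]⟩

theorem smul_left (c : ℂ) (hF : IsKMSFunction α β ω B C F) :
    IsKMSFunction α β ω (c • B) C (c • F) :=
  ⟨hF.strip.const_smul c, fun t => by simp [hF.lower], fun t => by simp [hF.upper]⟩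

theorem shift (h : ℝ) (hF : IsKMSFunction α β ω B C F) :
    IsKMSFunction α β ω B (α h C) (fun z => F (z + h)) := by
  refine ⟨hF.strip.comp_add_ofReal h, fun t => ?_, fun t => ?_⟩
  · rw [← α.act_add, ← hF.lower]
    push_cast
    rfl
  · rw [← α.act_add, ← hF.upper]
    push_cast
    ring_nf

theorem norm_le (hβ : 0 < β) (hF : IsKMSFunction α β ω B C F) {z : ℂ} (hz : 0 ≤ z.im)
    (hz' : z.im ≤ β) : ‖F z‖ ≤ ‖ω‖ * (‖B‖ * ‖C‖) := by
  refine hF.strip.norm_le hβ (fun t => ?_) (fun t => ?_) hz hz'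
  · rw [hF.lower]
    refine (ω.le_opNorm _).trans (mul_le_mul_of_nonneg_left ?_ (norm_nonneg _))
    exact (norm_mul_le _ _).trans_eq (by rw [α.norm_act])
  · rw [hF.upper]
    refine (ω.le_opNorm _).trans (mul_le_mul_of_nonneg_left ?_ (norm_nonneg _))
    exact (norm_mul_le _ _).trans_eq (by rw [α.norm_act, mul_comm])

/-- On both boundary lines Cauchy-Schwarz for the state and stationarity give the bound, and
Phragmén-Lindelöf carries it inside. This is the source of the factor β ω(A²) in Bogoliubov's
inequality. -/
theorem norm_le_of_isState (hβ : 0 < β) (hω : IsKMS α β ω)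
    (hF : IsKMSFunction α β ω (star B) B F) (hB : IsSelfAdjoint B) {z : ℂ} (hz : 0 ≤ z.im)
    (hz' : z.im ≤ β) : ‖F z‖ ≤ (ω (B * B)).re := by
  have hst : ∀ t, IsSelfAdjoint (α t B) := fun t => by
    rw [IsSelfAdjoint, ← map_star, hB.star_eq]
  have h0 := (hω.isState.nonneg B).1
  rw [hB.star_eq] at h0
  have e : ∀ t, ω (α t B * α t B) = ω (B * B) := fun t => by rw [← map_mul, hω.stationary]
  refine hF.strip.norm_le hβ (fun t => ?_) (fun t => ?_) hz hz'
  · rw [hF.lower]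
    have := (hω.isState.cauchySchwarz B (α t B)).2
    rw [(hst t).star_eq, e, hB.star_eq] at this
    rw [hB.star_eq]
    exact (sq_le_sq₀ (norm_nonneg _) h0).1 (this.trans_eq (sq _).symm)
  · rw [hF.upper]
    have := (hω.isState.cauchySchwarz (α t B) B).2
    rw [(hst t).star_eq, e, hB.star_eq] at this
    rw [hB.star_eq]
    exact (sq_le_sq₀ (norm_nonneg _) h0).1 (this.trans_eq (sq _).symm)

/-- Differentiability of the orbit of `C` gives the derivative of the KMS function. -/
theorem hasDerivAt (hβ : 0 < β) (hF : IsKMSFunction α β ω B C F)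
    (hG : IsKMSFunction α β ω B C' G) (hC : HasDerivAt (fun t : ℝ => α t C) C' 0) {z : ℂ}
    (hz : 0 < z.im) (hz' : z.im < β) : HasDerivAt F (G z) z := by
  have hopen : IsOpen {z : ℂ | 0 < z.im ∧ z.im < β} :=
    (isOpen_lt continuous_const Complex.continuous_im).inter
      (isOpen_lt Complex.continuous_im continuous_const)
  have hd : DifferentiableAt ℂ F z :=
    hF.strip.diffContOnCl.differentiableOn.differentiableAt (hopen.mem_nhds ⟨hz, hz'⟩)
  have h1 := hd.hasDerivAt
  suffices deriv F z = G z by rwa [this] at h1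
  have h2 : HasDerivAt (fun h : ℝ => F (z + h)) (deriv F z) 0 := by
    have h3 : HasDerivAt (fun h : ℝ => z + (h : ℂ)) 1 0 :=
      (Complex.ofRealCLM.hasDerivAt (x := (0 : ℝ))).const_add z
    have h4 : HasDerivAt F (deriv F z) (z + ((0 : ℝ) : ℂ)) := by simpa using h1
    have h5 := h4.comp (0 : ℝ) h3
    rw [mul_one] at h5
    exact h5
  rw [hasDerivAt_iff_tendsto_slope] at h2 hC
  refine tendsto_nhds_unique h2 ?_
  rw [tendsto_iff_norm_sub_tendsto_zero] at hC ⊢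
  have hC' := hC.const_mul (‖ω‖ * ‖B‖)
  rw [mul_zero] at hC'
  refine squeeze_zero (fun _ => norm_nonneg _) (fun h => ?_) hC'
  -- This is a KMS function for `B` and the difference quotient of the orbit minus `C'`, so the norm
  -- of that remainder controls the difference quotient of `F` throughout the strip.
  have hK := (((hF.shift h).add_right (hF.smul_right (-1))).smul_right ((h⁻¹ : ℝ) : ℂ)).add_right
    (hG.smul_right (-1))
  have := hK.norm_le hβ hz.le hz'.le
  convert this using 1
  · congr 1
    simp [slope, sub_eq_add_neg]
  · rw [mul_assoc]
    congr 3
    simp [slope, sub_eq_add_neg, α.act_zero]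
    simp only [← Complex.ofReal_inv, Complex.coe_smul]

end IsKMSFunction
end KMS

/-! ### Positivity of the Duhamel form and Bogoliubov's inequality. -/

section Positivity

variable {𝔄 : Type*} [CStarAlgebra 𝔄] {α : StarAction ℝ 𝔄} {β : ℝ} {ω : 𝔄 →L[ℂ] ℂ}

/-- The square-root kernel of the Gaussian centred at `i s`. -/
noncomputable def gaussianRoot (a s t : ℝ) : ℂ :=
  Complex.exp (-(2 * a) * (t - (s / 2) * Complex.I) ^ 2)

theorem continuous_gaussianRoot (a s : ℝ) : Continuous (gaussianRoot a s) := by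
  unfold gaussianRoot
  fun_prop

theorem norm_gaussianRoot (a s t : ℝ) :
    ‖gaussianRoot a s t‖ = Real.exp (-(2 * a) * t ^ 2) * Real.exp (a * s ^ 2 / 2) := by
  rw [gaussianRoot, Complex.norm_exp, ← Real.exp_add]
  congr 1
  simp [pow_two]
  ring

theorem integrable_gaussianRoot {a : ℝ} (ha : 0 < a) (s : ℝ) :
    Integrable fun t : ℝ => ‖gaussianRoot a s t‖ := by
  simp_rw [norm_gaussianRoot]
  exact (integrable_exp_neg_mul_sq (by positivity)).mul_const _

/-- Complete the square in `t`: the `t`-dependence separates into a Gaussian whose integral does not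
depend on `u`, leaving the Gaussian centred at `i s`. -/
theorem star_gaussianRoot_mul (a s t u : ℝ) :
    star (gaussianRoot a s t) * gaussianRoot a s (t + u) =
      ((Real.exp (-(4 * a) * (t + u / 2) ^ 2) : ℝ) : ℂ) *
        Complex.exp (-a * (u - s * Complex.I) ^ 2) := by
  have h : star (gaussianRoot a s t) = Complex.exp (-(2 * a) * (t + (s / 2) * Complex.I) ^ 2) := by
    rw [gaussianRoot, Complex.star_def, ← Complex.exp_conj]
    congr 1
    simp [show (starRingEnd ℂ) 2 = 2 from map_ofNat _ 2]
  rw [h, gaussianRoot, Complex.ofReal_exp, ← Complex.exp_add, ← Complex.exp_add]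
  congr 1
  push_cast
  ring

theorem integrable_gaussianRoot_smul {a : ℝ} (ha : 0 < a) (s : ℝ) (α : StarAction ℝ 𝔄) (B : 𝔄) :
    Integrable fun t : ℝ => gaussianRoot a s t • α t B := by
  refine ((integrable_gaussianRoot ha s).mul_const ‖B‖).mono' ?_ (Eventually.of_forall fun t => ?_)
  · exact ((continuous_gaussianRoot a s).smul (α.continuous_orbit B)).aestronglyMeasurable
  · rw [norm_smul, α.norm_act]

open scoped ComplexOrder in
theorem IsState.nonneg' (hω : IsState ω) (B : 𝔄) : 0 ≤ ω (star B * B) :=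
  Complex.nonneg_iff.2 ⟨(hω.nonneg B).1, (hω.nonneg B).2.symm⟩

open scoped ComplexOrder in
/-- Gaussian averages about `i s` of the correlation function of `B` are nonnegative. -/
theorem IsKMS.gaussian_nonneg (hω : IsKMS α β ω) (B : 𝔄) {a : ℝ} (ha : 0 < a) (s : ℝ) :
    0 ≤ ∫ u : ℝ, Complex.exp (-a * (u - s * Complex.I) ^ 2) * ω (star B * α u B) := by
  set g := gaussianRoot a s with hg
  set φ : ℝ → ℂ := fun u => ω (star B * α u B) with hφ
  have hφc : Continuous φ := ω.continuous.comp (continuous_const.mul (α.continuous_orbit B))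
  have hφb : ∀ u, ‖φ u‖ ≤ ‖ω‖ * (‖B‖ * ‖B‖) := fun u => by
    refine (ω.le_opNorm _).trans (mul_le_mul_of_nonneg_left ?_ (norm_nonneg _))
    exact (norm_mul_le _ _).trans_eq (by rw [α.norm_act, norm_star])
  have hgc : Continuous g := continuous_gaussianRoot a s
  set X : 𝔄 := ∫ t : ℝ, g t • α t B with hX
  have hXi := integrable_gaussianRoot_smul ha s α B
  have h0 := hω.isState.nonneg' X
  have hstar : star X = ∫ t : ℝ, star (g t) • star (α t B) := by
    have := ((starL' ℝ : 𝔄 ≃L[ℝ] 𝔄) : 𝔄 →L[ℝ] 𝔄).integral_comp_comm hXi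
    simp only [ContinuousLinearEquiv.coe_coe, starL'_apply, star_smul] at this
    exact this.symm
  have hstar_int : Integrable fun t : ℝ => star (g t) • star (α t B) := by
    have := ((starL' ℝ : 𝔄 ≃L[ℝ] 𝔄) : 𝔄 →L[ℝ] 𝔄).integrable_comp hXi
    simpa only [ContinuousLinearEquiv.coe_coe, starL'_apply, star_smul] using this
  have h1 : ω (star X * X) = ∫ t : ℝ, star (g t) * ω (star (α t B) * X) := by
    have := (ω.comp ((ContinuousLinearMap.mul ℂ 𝔄).flip X)).integral_comp_comm hstar_int
    rw [← hstar] at this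
    simp at this
    exact this.symm
  have h2 : ∀ t, ω (star (α t B) * X) = ∫ u : ℝ, g (t + u) * φ u := by
    intro t
    have := (ω.comp (ContinuousLinearMap.mul ℂ 𝔄 (star (α t B)))).integral_comp_comm hXi
    simp only [ContinuousLinearMap.comp_apply, ContinuousLinearMap.mul_apply', map_smul,
      smul_eq_mul] at this
    rw [← this, ← integral_add_left_eq_self _ t]
    congr 1 with u
    rw [hφ]
    simp only [hg]
    congr 1
    rw [α.act_add, ← map_star, ← map_mul, hω.stationary]
  have hint : Integrable (Function.uncurry fun t u : ℝ => star (g t) * (g (t + u) * φ u))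
      (volume.prod volume) := by
    have hb : Integrable (fun p : ℝ × ℝ => (Real.exp (-a * p.1 ^ 2) *
        (Real.exp (-(2 / 3 * a) * p.2 ^ 2) * (Real.exp (a * s ^ 2) * (‖ω‖ * (‖B‖ * ‖B‖))))))
        (volume.prod volume) :=
      (integrable_exp_neg_mul_sq ha).mul_prod
        ((integrable_exp_neg_mul_sq (by positivity)).mul_const _)
    refine hb.mono' (Continuous.aestronglyMeasurable (by fun_prop))
      (Eventually.of_forall fun p => ?_)
    simp only [Function.uncurry]
    rw [norm_mul, norm_mul, norm_star, hg, norm_gaussianRoot, norm_gaussianRoot]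
    -- The rate 2/3 makes the gap between the exponents a perfect square: 2p² + 2(p+u)² - p² -
    -- (2/3)u² = (3p + 2u)²/3.
    have e1 : Real.exp (-(2 * a) * p.1 ^ 2) * Real.exp (-(2 * a) * (p.1 + p.2) ^ 2)
        ≤ Real.exp (-a * p.1 ^ 2) * Real.exp (-(2 / 3 * a) * p.2 ^ 2) := by
      rw [← Real.exp_add, ← Real.exp_add, Real.exp_le_exp]
      nlinarith [mul_nonneg ha.le (sq_nonneg (3 * p.1 + 2 * p.2))]
    have e2 : Real.exp (a * s ^ 2 / 2) * Real.exp (a * s ^ 2 / 2) = Real.exp (a * s ^ 2) := by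
      rw [← Real.exp_add]; ring_nf
    calc _ = (Real.exp (-(2 * a) * p.1 ^ 2) * Real.exp (-(2 * a) * (p.1 + p.2) ^ 2)) *
          (Real.exp (a * s ^ 2 / 2) * Real.exp (a * s ^ 2 / 2)) * ‖φ p.2‖ := by ring
      _ ≤ (Real.exp (-a * p.1 ^ 2) * Real.exp (-(2 / 3 * a) * p.2 ^ 2)) * Real.exp (a * s ^ 2) *
          (‖ω‖ * (‖B‖ * ‖B‖)) := by
        rw [e2]
        gcongr
        exact hφb _
      _ = _ := by ring
  have hc : ∀ u : ℝ, ∫ t : ℝ, Real.exp (-(4 * a) * (t + u / 2) ^ 2) = √(Real.pi / (4 * a)) := by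
    intro u
    rw [integral_add_right_eq_self (fun t : ℝ => Real.exp (-(4 * a) * t ^ 2)), integral_gaussian]
  have h3 : ω (star X * X) = ((√(Real.pi / (4 * a)) : ℝ) : ℂ) *
      ∫ u : ℝ, Complex.exp (-a * (u - s * Complex.I) ^ 2) * φ u := by
    rw [h1]
    simp_rw [h2, ← integral_const_mul]
    rw [integral_integral_swap hint]
    congr 1 with u
    simp_rw [← mul_assoc, hg, star_gaussianRoot_mul]
    rw [integral_mul_const, integral_mul_const, integral_complex_ofReal, hc]
  rw [h3] at h0
  exact Complex.nonneg_of_ofReal_mul_nonneg (Real.sqrt_pos.2 (by positivity)) h0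

-- The contour shift turns the nonnegative averages on the real line into centred Gaussian averages
-- at height `s`.
open scoped ComplexOrder in
theorem IsKMSFunction.nonneg (hβ : 0 < β) (hω : IsKMS α β ω) {B : 𝔄} {F : ℂ → ℂ}
    (hF : IsKMSFunction α β ω (star B) B F) {s : ℝ} (hs : 0 ≤ s) (hs' : s ≤ β) :
    0 ≤ F (s * Complex.I) := by
  refine hF.strip.nonneg_of_gaussian hβ hs hs' fun a ha => ?_
  rw [← hF.strip.integral_gaussian_shift hβ ha hs hs']
  simp_rw [hF.lower]
  exact hω.gaussian_nonneg B ha s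

theorem IsKMSFunction.intervalIntegrable (hβ : 0 < β) {B C : 𝔄} {F : ℂ → ℂ}
    (hF : IsKMSFunction α β ω B C F) :
    IntervalIntegrable (fun s : ℝ => F (s * Complex.I)) volume 0 β := by
  refine ContinuousOn.intervalIntegrable ?_
  rw [Set.uIcc_of_le hβ.le]
  exact hF.strip.continuousOn_vertical hβ

/-- This is the positivity of the Duhamel form on the diagonal. -/
theorem IsKMSFunction.integral_vertical_nonneg (hβ : 0 < β) (hω : IsKMS α β ω) {B : 𝔄}
    {F : ℂ → ℂ} (hF : IsKMSFunction α β ω (star B) B F) :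
    0 ≤ (∫ s : ℝ in (0)..β, F (s * Complex.I)).re ∧
      (∫ s : ℝ in (0)..β, F (s * Complex.I)).im = 0 := by
  have e : ∀ s ∈ Set.uIcc 0 β, F (s * Complex.I) = (((F (s * Complex.I)).re : ℝ) : ℂ) := by
    intro s hs
    rw [Set.uIcc_of_le hβ.le] at hs
    have := Complex.nonneg_iff.1 (hF.nonneg hβ hω hs.1 hs.2)
    exact Complex.ext (by simp) (by simp [← this.2])
  rw [intervalIntegral.integral_congr e, intervalIntegral.integral_ofReal]
  refine ⟨?_, Complex.ofReal_im _⟩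
  rw [Complex.ofReal_re]
  exact intervalIntegral.integral_nonneg hβ.le fun s hs =>
    (Complex.nonneg_iff.1 (hF.nonneg hβ hω hs.1 hs.2)).1

/-- The commutator expectation as an integral of the KMS function over the imaginary segment. -/
theorem IsKMS.commutator_eq (hβ : 0 < β) (hω : IsKMS α β ω) {B C C' : 𝔄} {G : ℂ → ℂ}
    (hG : IsKMSFunction α β ω B C' G) (hC : HasDerivAt (fun t : ℝ => α t C) C' 0) :
    ω ⁅C, B⁆ = Complex.I * ∫ s : ℝ in (0)..β, G (s * Complex.I) := by
  obtain ⟨F, hF⟩ := hω.exists_isKMSFunction B C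
  have hd : ∀ s ∈ Set.Ioo 0 β,
      HasDerivAt (fun s : ℝ => F (s * Complex.I)) (Complex.I * G (s * Complex.I)) s := by
    intro s hs
    have h1 : HasDerivAt F (G (s * Complex.I)) (s * Complex.I) :=
      hF.hasDerivAt hβ hG hC (by simpa using hs.1) (by simpa using hs.2)
    have h2 : HasDerivAt (fun s : ℝ => (s : ℂ) * Complex.I) Complex.I s := by
      simpa using (Complex.ofRealCLM.hasDerivAt (x := s)).mul_const Complex.I
    have h3 := h1.comp s h2
    rw [mul_comm] at h3
    exact h3
  have h := intervalIntegral.integral_eq_sub_of_hasDerivAt_of_le hβ.le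
    (hF.strip.continuousOn_vertical hβ) hd ((hG.intervalIntegrable hβ).const_mul _)
  rw [intervalIntegral.integral_const_mul] at h
  rw [h]
  have h0 := hF.lower 0
  have h1 := hF.upper 0
  simp only [α.act_zero, Complex.ofReal_zero, zero_add] at h0 h1
  rw [Complex.ofReal_zero, zero_mul, h0, h1, Ring.lie_def, map_sub]

/-- **Bogoliubov's inequality** for a KMS state. -/
theorem IsKMS.bogoliubov (hβ : 0 < β) (hω : IsKMS α β ω) {A Q Q' : 𝔄} (hA : IsSelfAdjoint A)
    (hQ : IsSelfAdjoint Q) (hQ' : HasDerivAt (fun t : ℝ => α t Q) Q' 0) :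
    ‖ω ⁅Q, A⁆‖ ^ 2 ≤ β * (ω (A * A)).re * (ω ⁅Q, hamiltonianComm α Q⁆).re := by
  have hQ'sa : star Q' = Q' := by
    have h := hQ'.star
    have e : (fun t : ℝ => star (α t Q)) = fun t : ℝ => α t Q := by
      ext t
      rw [← map_star, hQ.star_eq]
    rw [e] at h
    exact h.unique hQ'
  obtain ⟨F11, h11⟩ := hω.exists_isKMSFunction (star A) A
  obtain ⟨F12, h12⟩ := hω.exists_isKMSFunction (star A) Q'
  obtain ⟨F21, h21⟩ := hω.exists_isKMSFunction (star Q') A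
  obtain ⟨F22, h22⟩ := hω.exists_isKMSFunction (star Q') Q'
  set D : (ℂ → ℂ) → ℂ := fun F => ∫ s : ℝ in (0)..β, F (s * Complex.I) with hD
  have p11 := h11.integral_vertical_nonneg hβ hω
  have p22 := h22.integral_vertical_nonneg hβ hω
  have e11 : (((D F11).re : ℝ) : ℂ) = D F11 := Complex.ext (by simp) (by simp [hD, p11.2])
  have e22 : (((D F22).re : ℝ) : ℂ) = D F22 := Complex.ext (by simp) (by simp [hD, p22.2])
  -- The combination of the four chosen functions is itself a KMS function for the vector `A + c •
  -- Q'`, so diagonal positivity applies without any uniqueness of the strip function.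
  have key := cauchySchwarz_of_nonneg (x := D F12) (y := D F21) p11.1 p22.1 fun c => by
    have hK := (h11.add_right (h12.smul_right c)).add_left
      (((h21.add_right (h22.smul_right c))).smul_left (star c))
    rw [← star_smul, ← star_add] at hK
    have hp := hK.integral_vertical_nonneg hβ hω
    have e : (∫ s : ℝ in (0)..β, (F11 + c • F12 + star c • (F21 + c • F22)) (s * Complex.I))
        = ((D F11).re : ℂ) + c * D F12 + star c * D F21 + star c * c * ((D F22).re : ℂ) := by
      rw [e11, e22]
      have i11 := h11.intervalIntegrable hβ
      have i12 := (h12.intervalIntegrable hβ).const_mul c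
      have i21 := h21.intervalIntegrable hβ
      have i22 := (h22.intervalIntegrable hβ).const_mul c
      simp only [Pi.add_apply, Pi.smul_apply, smul_eq_mul, hD]
      rw [intervalIntegral.integral_add (i11.add i12) ((i21.add i22).const_mul _),
        intervalIntegral.integral_add i11 i12, intervalIntegral.integral_const_mul,
        intervalIntegral.integral_const_mul, intervalIntegral.integral_add i21 i22,
        intervalIntegral.integral_const_mul]
      ring
    rw [e] at hp
    exact hp
  have c1 : ω ⁅Q, A⁆ = Complex.I * D F12 := by
    have := hω.commutator_eq hβ h12 hQ'
    rwa [hA.star_eq] at this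
  have c2 : ω ⁅Q, hamiltonianComm α Q⁆ = D F22 := by
    have := hω.commutator_eq hβ h22 hQ'
    rw [hQ'sa] at this
    rw [hamiltonianComm, hQ'.deriv, Ring.lie_def, mul_smul_comm, smul_mul_assoc, ← smul_sub,
      ← Ring.lie_def, map_smul, this, smul_eq_mul, ← mul_assoc, neg_mul,
      Complex.I_mul_I, neg_neg, one_mul]
  -- The integrand is at most ω(A²) on a segment of length β.
  have b11 : (D F11).re ≤ β * (ω (A * A)).re := by
    refine (Complex.re_le_norm _).trans ?_
    have := intervalIntegral.norm_integral_le_of_norm_le_const (a := 0) (b := β)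
      (f := fun s : ℝ => F11 (s * Complex.I)) (C := (ω (A * A)).re) fun s hs => by
        rw [Set.uIoc_of_le hβ.le] at hs
        exact h11.norm_le_of_isState hβ hω hA (by simpa using hs.1.le) (by simpa using hs.2)
    rwa [sub_zero, abs_of_pos hβ, mul_comm] at this
  rw [c1, c2, norm_mul, Complex.norm_I, one_mul]
  exact key.2.trans (mul_le_mul_of_nonneg_right b11 p22.1)

end Positivity

/-! ### Balls in a closed spanning subgroup have volume of order R^n. -/

section Volume

variable {n : ℕ} {Γ : AddSubgroup (EuclideanSpace ℝ (Fin n))}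

theorem AddSubgroup.properSpace_of_isClosed
    (h : IsClosed (Γ : Set (EuclideanSpace ℝ (Fin n)))) : ProperSpace Γ :=
  ⟨fun x r => h.isClosedEmbedding_subtypeVal.isCompact_preimage
    (isCompact_closedBall (x : EuclideanSpace ℝ (Fin n)) r)⟩

/-- A subgroup spanning `ℝⁿ` is relatively dense. -/
theorem AddSubgroup.exists_norm_sub_le_of_span
    (h : Submodule.span ℝ (Γ : Set (EuclideanSpace ℝ (Fin n))) = ⊤) :
    ∃ r : ℝ, 0 ≤ r ∧ ∀ z : EuclideanSpace ℝ (Fin n), ∃ x : Γ, ‖z - x‖ ≤ r := by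
  classical
  -- A real basis chosen inside `Γ` has all its integer combinations in `Γ`; rounding the
  -- coordinates down moves `z` by at most the sum of the ‖b i‖.
  set b := Module.Basis.ofSpan h.ge with hb
  have hbΓ : ∀ i, b i ∈ Γ := fun i =>
    Module.Basis.ofSpan_subset h.ge (Set.mem_range_self i)
  have : Fintype ((linearIndepOn_empty ℝ id).extend
      (Set.empty_subset (Γ : Set (EuclideanSpace ℝ (Fin n))))) :=
    FiniteDimensional.fintypeBasisIndex b
  refine ⟨∑ i, ‖b i‖, Finset.sum_nonneg fun i _ => norm_nonneg _, fun z => ?_⟩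
  have hfl : (ZSpan.floor b z : EuclideanSpace ℝ (Fin n)) ∈ Γ := by
    have h1 : Submodule.span ℤ (Set.range b) ≤ AddSubgroup.toIntSubmodule Γ := by
      rw [Submodule.span_le]
      rintro _ ⟨i, rfl⟩
      exact hbΓ i
    exact h1 (ZSpan.floor b z).2
  exact ⟨⟨_, hfl⟩, ZSpan.norm_fract_le b z⟩

theorem volume_closedBall_eq (x : EuclideanSpace ℝ (Fin n)) {r : ℝ} (hr : 0 ≤ r) :
    volume (Metric.closedBall x r) = ENNReal.ofReal (r ^ n) *
      volume (Metric.closedBall (0 : EuclideanSpace ℝ (Fin n)) 1) := by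
  rw [Measure.addHaar_closedBall' volume x hr, finrank_euclideanSpace_fin]

variable {μ : Measure Γ}

theorem setOf_norm_le_eq_closedBall (R : ℝ) : {x : Γ | ‖x‖ ≤ R} = Metric.closedBall 0 R := by
  ext x
  simp

theorem measure_closedBall_eq_of_isAddLeftInvariant [μ.IsAddLeftInvariant] (x : Γ) (r : ℝ) :
    μ (Metric.closedBall x r) = μ (Metric.closedBall 0 r) := by
  rw [← measure_preimage_add μ x]
  congr 1
  ext y
  simp [dist_eq_norm]

variable [ProperSpace Γ] [μ.IsAddHaarMeasure]

/-- Fubini's theorem for the pairs of points `z ∈ ℝⁿ`, `x ∈ Γ` at distance at most `ρ`. -/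
theorem lintegral_measure_near (R ρ : ℝ) :
    ∫⁻ z in Metric.closedBall (0 : EuclideanSpace ℝ (Fin n)) R, μ {x : Γ | ‖z - x‖ ≤ ρ} =
      ∫⁻ x : Γ, volume (Metric.closedBall (0 : EuclideanSpace ℝ (Fin n)) R ∩
        Metric.closedBall (x : EuclideanSpace ℝ (Fin n)) ρ) ∂μ := by
  set S : Set (EuclideanSpace ℝ (Fin n) × Γ) := {p | ‖p.1‖ ≤ R ∧ ‖p.1 - p.2‖ ≤ ρ} with hS
  have hSm : MeasurableSet S := by
    have c1 : Continuous fun p : EuclideanSpace ℝ (Fin n) × Γ => ‖p.1‖ := by fun_prop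
    have c2 : Continuous fun p : EuclideanSpace ℝ (Fin n) × Γ => ‖p.1 - p.2‖ := by fun_prop
    exact ((isClosed_le c1 continuous_const).inter
      (isClosed_le c2 continuous_const)).measurableSet
  have h1 := Measure.prod_apply (μ := volume) (ν := μ) hSm
  rw [Measure.prod_apply_symm hSm] at h1
  rw [← lintegral_indicator Metric.isClosed_closedBall.measurableSet]
  calc _ = ∫⁻ z, μ (Prod.mk z ⁻¹' S) := by
        congr 1 with z
        by_cases hz : ‖z‖ ≤ R
        · rw [Set.indicator_of_mem (by simpa using hz)]
          congr 1
          ext x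
          simp [hS, hz]
        · rw [Set.indicator_of_notMem (by simpa using hz)]
          have : Prod.mk z ⁻¹' S = ∅ := by
            ext x
            simp [hS, hz]
          rw [this, measure_empty]
    _ = _ := by
        rw [← h1]
        congr 1 with x
        congr 1
        ext z
        simp [hS, dist_eq_norm]

/-- Count pairs at distance at most 1 in two ways. Each `x` in the ball sees a full Euclidean unit
ball, and the points of `Γ` within 1 of a given `z` lie within 2 of each other. -/
theorem measure_closedBall_le_pow {R : ℝ} (hR : 0 ≤ R) :
    μ (Metric.closedBall 0 R) ≤
      μ (Metric.closedBall 0 2) * ENNReal.ofReal ((R + 1) ^ n) := by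
  have hv0 : volume (Metric.closedBall (0 : EuclideanSpace ℝ (Fin n)) 1) ≠ 0 :=
    (Metric.measure_closedBall_pos _ _ one_pos).ne'
  have hvt : volume (Metric.closedBall (0 : EuclideanSpace ℝ (Fin n)) 1) ≠ ⊤ :=
    measure_closedBall_lt_top.ne
  refine (ENNReal.mul_le_mul_iff_left hv0 hvt).1 ?_
  have h := lintegral_measure_near (μ := μ) (R + 1) 1
  calc _ = ∫⁻ x in Metric.closedBall (0 : Γ) R,
        volume (Metric.closedBall (0 : EuclideanSpace ℝ (Fin n)) 1) ∂μ := by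
        rw [setLIntegral_const, mul_comm]
    _ ≤ ∫⁻ x in Metric.closedBall (0 : Γ) R,
        volume (Metric.closedBall (0 : EuclideanSpace ℝ (Fin n)) (R + 1) ∩
        Metric.closedBall (x : EuclideanSpace ℝ (Fin n)) 1) ∂μ := by
        refine setLIntegral_mono' Metric.isClosed_closedBall.measurableSet fun x hx => ?_
        have hx' : ‖(x : EuclideanSpace ℝ (Fin n))‖ ≤ R := by simpa using hx
        rw [Set.inter_eq_right.2 (Metric.closedBall_subset_closedBall' (by
          rw [dist_zero_right]; linarith)),
          Measure.addHaar_closedBall_center volume (x : EuclideanSpace ℝ (Fin n))]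
    _ ≤ _ := setLIntegral_le_lintegral _ _
    _ ≤ ∫⁻ z in Metric.closedBall (0 : EuclideanSpace ℝ (Fin n)) (R + 1),
        μ (Metric.closedBall 0 2) := by
        rw [← h]
        refine lintegral_mono fun z => ?_
        rcases Set.eq_empty_or_nonempty {x : Γ | ‖z - x‖ ≤ 1} with he | ⟨y, hy⟩
        · simp only [he, measure_empty, zero_le]
        · refine (measure_mono fun x hx => ?_).trans_eq
            (measure_closedBall_eq_of_isAddLeftInvariant y 2)
          have h1 : ‖z - y‖ ≤ 1 := hy
          have h2 : ‖z - x‖ ≤ 1 := hx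
          rw [Metric.mem_closedBall, dist_eq_norm]
          have h3 : ((x - y : Γ) : EuclideanSpace ℝ (Fin n)) = (z - y) - (z - x) := by
            simp
          change ‖((x - y : Γ) : EuclideanSpace ℝ (Fin n))‖ ≤ 2
          rw [h3]
          exact (norm_sub_le _ _).trans (by linarith)
    _ = _ := by
        rw [setLIntegral_const, volume_closedBall_eq _ (by positivity), mul_assoc]

/-- The converse count, with pairs at distance at most r + 1: some point of `Γ` is within `r` of
`z`, and its whole unit ball in `Γ` then counts. -/
theorem pow_le_measure_closedBall {r : ℝ} (hr : 0 ≤ r)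
    (h : ∀ z : EuclideanSpace ℝ (Fin n), ∃ x : Γ, ‖z - x‖ ≤ r) {R : ℝ} (hR : 0 ≤ R) :
    μ (Metric.closedBall 0 1) * ENNReal.ofReal (R ^ n) ≤
      μ (Metric.closedBall 0 (R + (r + 1))) * ENNReal.ofReal ((r + 1) ^ n) := by
  have hv0 : volume (Metric.closedBall (0 : EuclideanSpace ℝ (Fin n)) 1) ≠ 0 :=
    (Metric.measure_closedBall_pos _ _ one_pos).ne'
  have hvt : volume (Metric.closedBall (0 : EuclideanSpace ℝ (Fin n)) 1) ≠ ⊤ :=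
    measure_closedBall_lt_top.ne
  refine (ENNReal.mul_le_mul_iff_left hv0 hvt).1 ?_
  have hf := lintegral_measure_near (μ := μ) R (r + 1)
  calc _ = ∫⁻ z in Metric.closedBall (0 : EuclideanSpace ℝ (Fin n)) R,
        μ (Metric.closedBall 0 1) := by
        rw [setLIntegral_const, volume_closedBall_eq _ hR, mul_assoc]
    _ ≤ ∫⁻ z in Metric.closedBall (0 : EuclideanSpace ℝ (Fin n)) R,
        μ {x : Γ | ‖z - x‖ ≤ r + 1} := by
        refine lintegral_mono fun z => ?_
        obtain ⟨y, hy⟩ := h z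
        rw [← measure_closedBall_eq_of_isAddLeftInvariant y 1]
        refine measure_mono fun x hx => ?_
        have h1 : ‖((x - y : Γ) : EuclideanSpace ℝ (Fin n))‖ ≤ 1 := by
          simpa [dist_eq_norm] using hx
        have h3 : z - x = (z - y) - ((x - y : Γ) : EuclideanSpace ℝ (Fin n)) := by simp
        change ‖z - x‖ ≤ r + 1
        rw [h3]
        exact (norm_sub_le _ _).trans (by linarith)
    _ ≤ ∫⁻ x in Metric.closedBall (0 : Γ) (R + (r + 1)),
        volume (Metric.closedBall (0 : EuclideanSpace ℝ (Fin n)) (r + 1)) ∂μ := by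
        rw [hf, ← lintegral_indicator Metric.isClosed_closedBall.measurableSet]
        refine lintegral_mono fun x => ?_
        by_cases hx : x ∈ Metric.closedBall (0 : Γ) (R + (r + 1))
        · rw [Set.indicator_of_mem hx, volume_closedBall_eq 0 (by positivity),
            ← volume_closedBall_eq (x : EuclideanSpace ℝ (Fin n)) (by positivity)]
          exact measure_mono Set.inter_subset_right
        · rw [Set.indicator_of_notMem hx, nonpos_iff_eq_zero]
          convert measure_empty (μ := volume)
          refine Set.eq_empty_of_forall_notMem fun z hz => hx ?_
          have h1 : ‖z‖ ≤ R := by simpa using hz.1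
          have h2 : ‖z - x‖ ≤ r + 1 := by simpa [dist_eq_norm] using hz.2
          have h3 : (x : EuclideanSpace ℝ (Fin n)) = z - (z - x) := by simp
          have h4 : ‖(x : EuclideanSpace ℝ (Fin n))‖ ≤ R + (r + 1) := by
            rw [h3]
            exact (norm_sub_le _ _).trans (by linarith)
          simpa using h4
    _ = _ := by
        rw [setLIntegral_const, volume_closedBall_eq 0 (by positivity), mul_assoc]
        ring

theorem ballVolume_le_pow : ∃ C : ℝ, 0 < C ∧ ∀ R : ℝ, 1 ≤ R → ballVolume μ R ≤ C * R ^ n := by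
  refine ⟨(ballVolume μ 2 + 1) * 2 ^ n, by unfold ballVolume; positivity, fun R hR => ?_⟩
  have h := ENNReal.toReal_mono
    (ENNReal.mul_ne_top measure_closedBall_lt_top.ne ENNReal.ofReal_ne_top)
    (measure_closedBall_le_pow (μ := μ) (zero_le_one.trans hR))
  rw [ENNReal.toReal_mul, ENNReal.toReal_ofReal (by positivity)] at h
  simp only [ballVolume, setOf_norm_le_eq_closedBall]
  refine h.trans ?_
  rw [mul_assoc, ← mul_pow]
  have h1 : R + 1 ≤ 2 * R := by linarith
  have h2 : (μ (Metric.closedBall 0 2)).toReal ≤ μ.real (Metric.closedBall 0 2) + 1 :=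
    (le_add_iff_nonneg_right _).2 zero_le_one
  gcongr

theorem pow_le_ballVolume
    (h : Submodule.span ℝ (Γ : Set (EuclideanSpace ℝ (Fin n))) = ⊤) :
    ∃ c : ℝ, 0 < c ∧ ∀ᶠ R : ℝ in atTop, c * R ^ n ≤ ballVolume μ R := by
  obtain ⟨r, hr, hrd⟩ := AddSubgroup.exists_norm_sub_le_of_span h
  have hV : 0 < ballVolume μ 1 := by
    rw [ballVolume, setOf_norm_le_eq_closedBall]
    exact ENNReal.toReal_pos (Metric.measure_closedBall_pos _ _ one_pos).ne'
      measure_closedBall_lt_top.ne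
  refine ⟨ballVolume μ 1 / (2 * (r + 1)) ^ n, by positivity, ?_⟩
  filter_upwards [eventually_ge_atTop (2 * (r + 1))] with R hR
  have h1 := ENNReal.toReal_mono
    (ENNReal.mul_ne_top measure_closedBall_lt_top.ne ENNReal.ofReal_ne_top)
    (pow_le_measure_closedBall (μ := μ) hr hrd (R := R - (r + 1)) (by linarith))
  have h0 : 0 ≤ R - (r + 1) := by linarith
  rw [ENNReal.toReal_mul, ENNReal.toReal_mul, ENNReal.toReal_ofReal (by positivity),
    ENNReal.toReal_ofReal (by positivity), sub_add_cancel] at h1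
  rw [div_mul_eq_mul_div, div_le_iff₀ (by positivity), mul_pow, ← mul_assoc]
  have h2 : R ^ n ≤ (R - (r + 1)) ^ n * 2 ^ n := by
    rw [← mul_pow]
    exact pow_le_pow_left₀ (by linarith) (by linarith) _
  simp only [ballVolume, setOf_norm_le_eq_closedBall, Measure.real] at hV ⊢
  calc _ ≤ (μ (Metric.closedBall 0 1)).toReal * ((R - (r + 1)) ^ n * 2 ^ n) := by gcongr
    _ = ((μ (Metric.closedBall 0 1)).toReal * (R - (r + 1)) ^ n) * 2 ^ n := by ring
    _ ≤ ((μ (Metric.closedBall 0 R)).toReal * (r + 1) ^ n) * 2 ^ n := by gcongr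
    _ = _ := by ring

end Volume

/-! ### Lipschitz bounds for the cut-off. -/

section Cutoff

variable {f : ℝ → ℝ}

/-- The profile is constant off [1, 2], and its derivative is bounded there by compactness. -/
theorem IsCutoff.exists_lipschitz (hf : IsCutoff f) :
    ∃ L : ℝ, 0 ≤ L ∧ ∀ s t, |f s - f t| ≤ L * |s - t| := by
  have hd : Differentiable ℝ f := hf.smooth.differentiable (by simp)
  have hc : Continuous (deriv f) := hf.smooth.continuous_deriv (by simp)
  obtain ⟨C, hC⟩ := (isCompact_Icc (a := (1 : ℝ)) (b := 2)).exists_bound_of_continuousOn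
    hc.continuousOn
  have hC0 : 0 ≤ C := (norm_nonneg _).trans (hC 1 (by simp))
  refine ⟨C, hC0, fun s t => ?_⟩
  refine Convex.norm_image_sub_le_of_norm_deriv_le (s := Set.univ) (fun x _ => hd x)
    (fun x _ => ?_) convex_univ (Set.mem_univ t) (Set.mem_univ s)
  rcases lt_or_ge x 1 with h1 | h1
  · have : f =ᶠ[𝓝 x] fun _ => 1 := by
      filter_upwards [eventually_lt_nhds h1] with y hy using hf.eq_one y hy.le
    rw [this.deriv_eq]
    simpa using hC0
  rcases le_or_gt x 2 with h2 | h2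
  · exact hC x ⟨h1, h2⟩
  · have : f =ᶠ[𝓝 x] fun _ => 0 := by
      filter_upwards [eventually_gt_nhds h2] with y hy using hf.eq_zero y hy.le
    rw [this.deriv_eq]
    simpa using hC0

theorem IsCutoff.le_of_lipschitz (hf : IsCutoff f) {L : ℝ} (hL : 0 ≤ L)
    (h : ∀ s t, |f s - f t| ≤ L * |s - t|) (s : ℝ) : f s ≤ 1 + L := by
  rcases le_or_gt s 1 with h1 | h1
  · rw [hf.eq_one s h1]; linarith
  rcases le_or_gt 2 s with h2 | h2
  · rw [hf.eq_zero s h2]; linarith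
  · have h3 := (le_abs_self _).trans (h s 1)
    rw [hf.eq_one 1 le_rfl, abs_of_pos (by linarith)] at h3
    nlinarith

theorem abs_cutoff_sub_le {E : Type*} [SeminormedAddCommGroup E] {L : ℝ} (hL : 0 ≤ L)
    (h : ∀ s t, |f s - f t| ≤ L * |s - t|) {R : ℝ} (hR : 0 < R) (x y : E) :
    |f (‖x‖ / R) - f (‖y‖ / R)| ≤ L / R * ‖x - y‖ := by
  refine (h _ _).trans ?_
  rw [← sub_div, abs_div, abs_of_pos hR, div_mul_eq_mul_div, mul_div_assoc]
  gcongr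
  exact abs_norm_sub_norm_le x y

end Cutoff

/-! ### Double integrals of functions of a difference. -/

section Convolution

variable {G 𝕜 : Type*} [AddCommGroup G] [MeasurableSpace G] [MeasurableAdd₂ G] [MeasurableNeg G]
  {μ : Measure G} [SFinite μ] [μ.IsAddLeftInvariant] [RCLike 𝕜] {h k : G → 𝕜}

theorem integrable_mul_comp_sub (hh : Integrable h μ) (hk : Integrable k μ) :
    Integrable (fun p : G × G => h p.2 * k (p.1 - p.2)) (μ.prod μ) :=
  hh.convolution_integrand (ContinuousLinearMap.mul 𝕜 𝕜) hk

theorem integral_mul_comp_sub (hh : Integrable h μ) (hk : Integrable k μ) :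
    ∫ p : G × G, h p.2 * k (p.1 - p.2) ∂(μ.prod μ) = (∫ x, h x ∂μ) * ∫ x, k x ∂μ := by
  rw [integral_prod_symm _ (integrable_mul_comp_sub hh hk)]
  simp only [integral_const_mul]
  simp_rw [integral_sub_right_eq_self k]
  rw [integral_mul_const]

theorem integrable_mul_comp_sub_of_even (hh : Integrable h μ) (hk : Integrable k μ)
    (he : ∀ x, k (-x) = k x) :
    Integrable (fun p : G × G => h p.1 * k (p.1 - p.2)) (μ.prod μ) := by
  refine (integrable_mul_comp_sub hh hk).swap.congr (Eventually.of_forall fun p => ?_)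
  simp only [Function.comp, Prod.fst_swap, Prod.snd_swap]
  rw [← neg_sub, he]

theorem integral_mul_comp_sub_of_even (hh : Integrable h μ) (hk : Integrable k μ)
    (he : ∀ x, k (-x) = k x) :
    ∫ p : G × G, h p.1 * k (p.1 - p.2) ∂(μ.prod μ) = (∫ x, h x ∂μ) * ∫ x, k x ∂μ := by
  rw [← integral_mul_comp_sub hh hk, ← integral_prod_swap]
  congr 1 with p
  simp only [Prod.fst_swap, Prod.snd_swap]
  rw [← neg_sub, he]

end Convolution

/-! ### Cut-off averages and the boundary estimate. -/

section Cutoffs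

variable {n : ℕ} {Γ : AddSubgroup (EuclideanSpace ℝ (Fin n))}
  {μ : Measure Γ} {f : ℝ → ℝ}

theorem IsCutoff.continuous_norm_div (hf : IsCutoff f) (R : ℝ) :
    Continuous fun x : Γ => f (‖x‖ / R) :=
  hf.smooth.continuous.comp (continuous_norm.div_const R)

/-- The error made by replacing a cut-off by 1: the Lipschitz bound gives pointwise decay, and the
cap 2 + L, which bounds |f - 1|, gives domination without any moment of `a`. -/
theorem tendsto_integral_min_mul {L : ℝ} (hL : 0 ≤ L) {a : Γ → ℂ} (ha : Integrable a μ) :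
    Tendsto (fun R : ℝ => ∫ x, min (2 + L) (L / R * ‖x‖) * ‖a x‖ ∂μ) atTop (𝓝 0) := by
  rw [← integral_zero Γ ℝ (μ := μ)]
  refine tendsto_integral_filter_of_dominated_convergence (fun x => (2 + L) * ‖a x‖)
    (Eventually.of_forall fun R => ?_) ?_ (ha.norm.const_mul _) (Eventually.of_forall fun x => ?_)
  · exact AEStronglyMeasurable.mul (Continuous.aestronglyMeasurable (by fun_prop))
      ha.aestronglyMeasurable.norm
  · filter_upwards [eventually_gt_atTop 0] with R hR
    refine Eventually.of_forall fun x => ?_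
    rw [norm_mul, norm_norm, Real.norm_of_nonneg (le_min (by linarith) (by positivity))]
    gcongr
    exact min_le_left _ _
  · have h1 : Tendsto (fun R : ℝ => L / R * ‖x‖) atTop (𝓝 0) := by
      simpa using (tendsto_const_nhds.div_atTop tendsto_id).mul_const ‖x‖
    have h2 := (tendsto_const_nhds (x := 2 + L)).min h1
    rw [min_eq_right (by linarith)] at h2
    simpa using h2.mul_const ‖a x‖

variable [μ.IsAddHaarMeasure]

/-- Cut-off averages of an integrable function, centred at points of the unit region of the
cut-off, converge uniformly to the full integral. -/
theorem IsCutoff.norm_integral_sub_le (hf : IsCutoff f) {L : ℝ} (hL : 0 ≤ L)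
    (hLip : ∀ s t, |f s - f t| ≤ L * |s - t|) {a : Γ → ℂ} (ha : Integrable a μ) {R : ℝ}
    (hR : 0 < R) {y : Γ} (hy : ‖y‖ ≤ R) :
    ‖(∫ x, ((f (‖x‖ / R) : ℝ) : ℂ) * a (x - y) ∂μ) - ∫ x, a x ∂μ‖ ≤
      ∫ x, min (2 + L) (L / R * ‖x‖) * ‖a x‖ ∂μ := by
  have e : ∫ x, ((f (‖x‖ / R) : ℝ) : ℂ) * a (x - y) ∂μ =
      ∫ x, ((f (‖x + y‖ / R) : ℝ) : ℂ) * a x ∂μ := by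
    rw [← integral_add_right_eq_self _ y]
    simp
  have hfb : ∀ s, |f s| ≤ 1 + L := fun s => by
    rw [abs_of_nonneg (hf.nonneg s)]; exact hf.le_of_lipschitz hL hLip s
  have hc : Continuous fun x : Γ => f (‖x + y‖ / R) :=
    (hf.continuous_norm_div R).comp (continuous_add_const y)
  have i1 : Integrable (fun x => ((f (‖x + y‖ / R) : ℝ) : ℂ) * a x) μ :=
    ha.bdd_mul (c := 1 + L) (Complex.continuous_ofReal.comp hc).aestronglyMeasurable
      (Eventually.of_forall fun x => by simpa using hfb _)
  rw [e, ← integral_sub i1 ha]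
  have i2 : Integrable (fun x => min (2 + L) (L / R * ‖x‖) * ‖a x‖) μ := by
    refine ha.norm.bdd_mul (c := 2 + L) (Continuous.aestronglyMeasurable (by fun_prop))
      (Eventually.of_forall fun x => ?_)
    rw [Real.norm_of_nonneg (le_min (by linarith) (by positivity))]
    exact min_le_left _ _
  refine norm_integral_le_of_norm_le i2 (Eventually.of_forall fun x => ?_)
  have e2 : ((f (‖x + y‖ / R) : ℝ) : ℂ) * a x - a x = ((f (‖x + y‖ / R) - 1 : ℝ) : ℂ) * a x := by
    push_cast; ring
  rw [e2, norm_mul, Complex.norm_real, Real.norm_eq_abs]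
  gcongr
  refine le_min ?_ ?_
  · refine (abs_sub _ _).trans ?_
    rw [abs_one]
    linarith [hfb (‖x + y‖ / R)]
  · rw [← hf.eq_one (‖y‖ / R) ((div_le_one hR).2 hy)]
    simpa using abs_cutoff_sub_le hL hLip hR (x + y) y

variable [ProperSpace Γ]

theorem IsCutoff.hasCompactSupport (hf : IsCutoff f) {R : ℝ} (hR : 0 < R) :
    HasCompactSupport fun x : Γ => f (‖x‖ / R) := by
  refine HasCompactSupport.intro (isCompact_closedBall (0 : Γ) (2 * R)) fun x hx => ?_
  refine hf.eq_zero _ ?_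
  rw [le_div_iff₀ hR]
  simpa using (not_le.1 fun h => hx (by simpa using h)).le

/-- The cut-off double integral of an even kernel with vanishing integral and finite second
moment is a boundary term, smaller than the volume by two powers of the radius. -/
theorem IsCutoff.norm_double_integral_le (hf : IsCutoff f) {L : ℝ} (hL : 0 ≤ L)
    (hLip : ∀ s t, |f s - f t| ≤ L * |s - t|) {g : Γ → ℂ} (hg : Integrable g μ)
    (hg2 : Integrable (fun x => ‖x‖ ^ 2 * ‖g x‖) μ) (heven : ∀ x, g (-x) = g x)
    (hzero : ∫ x, g x ∂μ = 0) {R : ℝ} (hR : 0 < R) :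
    ‖∫ p : Γ × Γ, ((f (‖p.1‖ / R) * f (‖p.2‖ / R) : ℝ) : ℂ) * g (p.1 - p.2) ∂(μ.prod μ)‖ ≤
      (L / R) ^ 2 * (ballVolume μ (2 * R) * ∫ x, ‖x‖ ^ 2 * ‖g x‖ ∂μ) := by
  set w : Γ → ℝ := fun x => f (‖x‖ / R) with hw
  have hwc : Continuous w := hf.continuous_norm_div R
  have hwcs : HasCompactSupport w := hf.hasCompactSupport hR
  have hh : Integrable (fun x => ((w x ^ 2 : ℝ) : ℂ)) μ := by
    refine Continuous.integrable_of_hasCompactSupport (by fun_prop) ?_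
    exact hwcs.comp_left (g := fun r : ℝ => ((r ^ 2 : ℝ) : ℂ)) (by simp)
  set k : Γ → ℝ := fun x => ‖x‖ ^ 2 * ‖g x‖ with hk
  have hkeven : ∀ x, k (-x) = k x := fun x => by simp only [hk, norm_neg, heven]
  set B : Set Γ := {x : Γ | ‖x‖ ≤ 2 * R} with hB
  have hBm : MeasurableSet B := by
    rw [hB, setOf_norm_le_eq_closedBall]; exact Metric.isClosed_closedBall.measurableSet
  have hBf : μ B ≠ ⊤ := by
    rw [hB, setOf_norm_le_eq_closedBall]; exact measure_closedBall_lt_top.ne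
  have h1 : Integrable (B.indicator (1 : Γ → ℝ)) μ :=
    (integrable_indicator_iff hBm).2 (integrableOn_const hBf)
  have i1 := integrable_mul_comp_sub hh hg
  have i2 := integrable_mul_comp_sub_of_even hh hg heven
  have e1 := integral_mul_comp_sub hh hg
  have e2 := integral_mul_comp_sub_of_even hh hg heven
  rw [hzero, mul_zero] at e1 e2
  have j1 := integrable_mul_comp_sub h1 hg2
  have j2 := integrable_mul_comp_sub_of_even h1 hg2 hkeven
  have d1 := integral_mul_comp_sub h1 hg2
  have d2 := integral_mul_comp_sub_of_even h1 hg2 hkeven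
  have hV : ∫ x, B.indicator (1 : Γ → ℝ) x ∂μ = ballVolume μ (2 * R) := integral_indicator_one hBm
  rw [hV] at d1 d2
  -- Subtracting ½(w(x)² + w(y)²) g(x - y) costs nothing, as `g` has zero integral, and leaves
  -- -½(w(x) - w(y))² g(x - y).
  set D : Γ × Γ → ℂ := fun p => ((w p.1 * w p.2 : ℝ) : ℂ) * g (p.1 - p.2) -
    ((1 / 2 : ℂ) * (((w p.2 ^ 2 : ℝ) : ℂ) * g (p.1 - p.2)) +
      (1 / 2 : ℂ) * (((w p.1 ^ 2 : ℝ) : ℂ) * g (p.1 - p.2))) with hD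
  have hgm : AEStronglyMeasurable (fun p : Γ × Γ => g (p.1 - p.2)) (μ.prod μ) :=
    hg.aestronglyMeasurable.comp_quasiMeasurePreserving
      (quasiMeasurePreserving_sub_of_right_invariant μ μ)
  have i0 : Integrable (fun p : Γ × Γ => ((w p.1 * w p.2 : ℝ) : ℂ) * g (p.1 - p.2))
      (μ.prod μ) := by
    refine (i1.norm.add i2.norm).mono' (AEStronglyMeasurable.mul
      (Continuous.aestronglyMeasurable (by fun_prop)) hgm) (Eventually.of_forall fun p => ?_)
    simp only [Pi.add_apply, norm_mul, Complex.norm_real, Real.norm_eq_abs]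
    rw [← add_mul]
    gcongr
    rw [abs_pow, abs_pow]
    nlinarith [sq_nonneg (|w p.1| - |w p.2|), sq_nonneg (|w p.1|), sq_nonneg (|w p.2|)]
  have hint : ∫ p : Γ × Γ, ((w p.1 * w p.2 : ℝ) : ℂ) * g (p.1 - p.2) ∂(μ.prod μ) =
      ∫ p, D p ∂(μ.prod μ) := by
    have i3 : Integrable (fun p : Γ × Γ => (1 / 2 : ℂ) * (((w p.2 ^ 2 : ℝ) : ℂ) * g (p.1 - p.2)) +
        (1 / 2 : ℂ) * (((w p.1 ^ 2 : ℝ) : ℂ) * g (p.1 - p.2))) (μ.prod μ) :=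
      (i1.const_mul (1 / 2 : ℂ)).add (i2.const_mul (1 / 2 : ℂ))
    simp only [hD]
    rw [integral_sub i0 i3, integral_add (i1.const_mul _) (i2.const_mul _),
      integral_const_mul, integral_const_mul, e1, e2]
    simp
  have hbound : ∀ p, ‖D p‖ ≤ (L / R) ^ 2 / 2 * (B.indicator (1 : Γ → ℝ) p.2 * k (p.1 - p.2) +
      B.indicator (1 : Γ → ℝ) p.1 * k (p.1 - p.2)) := by
    intro p
    have hDe : D p = ((-(1 / 2) * (w p.1 - w p.2) ^ 2 : ℝ) : ℂ) * g (p.1 - p.2) := by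
      simp only [hD]
      push_cast
      ring
    have hn : ‖D p‖ = 1 / 2 * (w p.1 - w p.2) ^ 2 * ‖g (p.1 - p.2)‖ := by
      rw [hDe, norm_mul, Complex.norm_real, Real.norm_eq_abs, abs_mul, abs_neg,
        abs_of_pos one_half_pos,
        abs_of_nonneg (sq_nonneg _)]
    rw [hn]
    -- Both cut-offs vanish unless one of the points lies in the ball of radius 2R; this localizes
    -- the estimate to one volume factor.
    by_cases hp : p.1 ∈ B ∨ p.2 ∈ B
    · have h3 : (1 : ℝ) ≤ B.indicator (1 : Γ → ℝ) p.2 + B.indicator (1 : Γ → ℝ) p.1 := by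
        have ha : ∀ z, 0 ≤ B.indicator (1 : Γ → ℝ) z :=
          fun z => Set.indicator_nonneg (fun _ _ => zero_le_one) z
        rcases hp with hp | hp
        · rw [Set.indicator_of_mem hp]; simpa using ha p.2
        · rw [Set.indicator_of_mem hp]; simpa using ha p.1
      have h4 : (w p.1 - w p.2) ^ 2 ≤ (L / R * ‖p.1 - p.2‖) ^ 2 := by
        rw [← sq_abs (w p.1 - w p.2)]
        exact pow_le_pow_left₀ (abs_nonneg _) (abs_cutoff_sub_le hL hLip hR _ _) 2
      calc _ ≤ 1 / 2 * (L / R * ‖p.1 - p.2‖) ^ 2 * ‖g (p.1 - p.2)‖ := by gcongr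
        _ = (L / R) ^ 2 / 2 * (1 * k (p.1 - p.2)) := by simp only [hk]; ring
        _ ≤ _ := by
          rw [← add_mul]
          gcongr
    · rw [not_or] at hp
      have hz : ∀ z, z ∉ B → w z = 0 := fun z hz => by
        refine hf.eq_zero _ ?_
        rw [le_div_iff₀ hR]
        exact (not_le.1 hz).le
      rw [hz _ hp.1, hz _ hp.2, Set.indicator_of_notMem hp.1, Set.indicator_of_notMem hp.2]
      simp
  rw [hint]
  refine (norm_integral_le_of_norm_le ((j1.add j2).const_mul ((L / R) ^ 2 / 2))
    (Eventually.of_forall hbound)).trans_eq ?_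
  rw [integral_const_mul]
  simp only [Pi.add_apply]
  rw [integral_add j1 j2, d1, d2]
  ring

end Cutoffs

/-! ### Commutators with local charges. -/

section Commutators

variable {𝔄 : Type*} [CStarAlgebra 𝔄]

/-- The functional `C ↦ ω ([C, B])`. -/
noncomputable def commFunctional (ω : 𝔄 →L[ℂ] ℂ) (B : 𝔄) : 𝔄 →L[ℂ] ℂ :=
  ω.comp ((ContinuousLinearMap.mul ℂ 𝔄).flip B - ContinuousLinearMap.mul ℂ 𝔄 B)

theorem commFunctional_apply (ω : 𝔄 →L[ℂ] ℂ) (B C : 𝔄) : commFunctional ω B C = ω ⁅C, B⁆ := by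
  simp [commFunctional, Ring.lie_def]

theorem map_lie_skew (ω : 𝔄 →L[ℂ] ℂ) (B C : 𝔄) : ω ⁅B, C⁆ = -ω ⁅C, B⁆ := by
  rw [Ring.lie_def, Ring.lie_def, ← map_neg, neg_sub]

theorem map_lie_act {G : Type*} [AddCommGroup G] [TopologicalSpace G] {τ : StarAction G 𝔄}
    {ω : 𝔄 →L[ℂ] ℂ} (hωτ : ∀ (x : G) (B : 𝔄), ω (τ x B) = ω B) (B C : 𝔄) (x y : G) :
    ω ⁅τ x B, τ y C⁆ = ω ⁅τ (x - y) B, C⁆ := by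
  rw [← hωτ y ⁅τ (x - y) B, C⁆]
  simp only [Ring.lie_def, map_sub, map_mul]
  rw [← τ.act_add, add_sub_cancel]

theorem continuous_map_lie_act {G : Type*} [AddGroup G] [TopologicalSpace G] (τ : StarAction G 𝔄)
    (ω : 𝔄 →L[ℂ] ℂ) (B C : 𝔄) : Continuous fun x => ω ⁅τ x B, C⁆ := by
  simp_rw [← commFunctional_apply]
  exact (commFunctional ω C).continuous.comp (τ.continuous_orbit B)

theorem continuous_lie_act {G : Type*} [AddGroup G] [TopologicalSpace G] (τ : StarAction G 𝔄)
    (B C : 𝔄) : Continuous fun x => ⁅τ x B, C⁆ := by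
  simp only [Ring.lie_def]
  exact ((τ.continuous_orbit B).mul_const C).sub ((τ.continuous_orbit B).const_mul C)

end Commutators

section Charges

variable {n : ℕ} {Γ : AddSubgroup (EuclideanSpace ℝ (Fin n))}
  {μ : Measure Γ} {𝔄 : Type*} [CStarAlgebra 𝔄] {τ : StarAction Γ 𝔄}
  {f : ℝ → ℝ} {ω : 𝔄 →L[ℂ] ℂ}

theorem isSelfAdjoint_charge {q : 𝔄} (hq : IsSelfAdjoint q) (R : ℝ) :
    IsSelfAdjoint (charge τ μ f q R) := by
  have h := ((starL' ℝ : 𝔄 ≃L[ℝ] 𝔄)).integral_comp_comm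
    (fun x : Γ => ((f (‖x‖ / R) : ℝ) : ℂ) • τ x q) (μ := μ)
  simp only [starL'_apply, star_smul, ← map_star, hq.star_eq] at h
  rw [IsSelfAdjoint, charge, ← h]
  simp

theorem integrable_map_lie {q C : 𝔄} (h : Integrable (fun x : Γ => ‖⁅τ x q, C⁆‖) μ) :
    Integrable (fun x : Γ => ω ⁅τ x q, C⁆) μ :=
  (h.const_mul ‖ω‖).mono' (continuous_map_lie_act τ ω q C).aestronglyMeasurable
    (Eventually.of_forall fun _ => ω.le_opNorm _)

theorem isSelfAdjoint_bulk {A : 𝔄} (hA : IsSelfAdjoint A) (R : ℝ) :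
    IsSelfAdjoint (bulk τ μ A R) := by
  have h := ((starL' ℝ : 𝔄 ≃L[ℝ] 𝔄)).integral_comp_comm
    (fun x : Γ => τ x A) (μ := μ.restrict {x : Γ | ‖x‖ ≤ R})
  simp only [starL'_apply, ← map_star, hA.star_eq] at h
  rw [IsSelfAdjoint, bulk, ← h]

theorem isSelfAdjoint_bulkMean {A : 𝔄} (hA : IsSelfAdjoint A) (R : ℝ) :
    IsSelfAdjoint (bulkMean τ μ A R) := by
  rw [IsSelfAdjoint, bulkMean, star_smul, (isSelfAdjoint_bulk hA R).star_eq]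
  simp

variable [ProperSpace Γ] [μ.IsAddHaarMeasure]

theorem integrable_cutoff_smul (hf : IsCutoff f) (τ : StarAction Γ 𝔄) (B : 𝔄) {R : ℝ}
    (hR : 0 < R) : Integrable (fun x : Γ => ((f (‖x‖ / R) : ℝ) : ℂ) • τ x B) μ := by
  refine Continuous.integrable_of_hasCompactSupport
    ((Complex.continuous_ofReal.comp (hf.continuous_norm_div R)).smul (τ.continuous_orbit B)) ?_
  refine HasCompactSupport.smul_right (f := fun x : Γ => ((f (‖x‖ / R) : ℝ) : ℂ)) ?_
  exact (hf.hasCompactSupport hR).comp_left (g := fun r : ℝ => (r : ℂ)) Complex.ofReal_zero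

theorem map_charge {F : Type*} [NormedAddCommGroup F] [NormedSpace ℂ F] [CompleteSpace F]
    (hf : IsCutoff f) (T : 𝔄 →L[ℂ] F) (B : 𝔄) {R : ℝ} (hR : 0 < R) :
    T (charge τ μ f B R) = ∫ x : Γ, ((f (‖x‖ / R) : ℝ) : ℂ) • T (τ x B) ∂μ := by
  rw [charge, ← T.integral_comp_comm (integrable_cutoff_smul hf τ B hR)]
  simp only [map_smul]

/-- The charge as a continuous linear function of the density. -/
noncomputable def chargeL (τ : StarAction Γ 𝔄) (μ : Measure Γ) [μ.IsAddHaarMeasure]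
    (hf : IsCutoff f) {R : ℝ} (hR : 0 < R) : 𝔄 →L[ℂ] 𝔄 :=
  LinearMap.mkContinuous
    { toFun := fun B => charge τ μ f B R
      map_add' := fun B C => by
        simp only [charge, map_add, smul_add]
        exact integral_add (integrable_cutoff_smul hf τ B hR) (integrable_cutoff_smul hf τ C hR)
      map_smul' := fun c B => by
        simp only [charge, map_smul, smul_comm _ c, RingHom.id_apply]
        exact integral_smul c _ } (∫ x : Γ, |f (‖x‖ / R)| ∂μ) fun B => by
    change ‖∫ x : Γ, ((f (‖x‖ / R) : ℝ) : ℂ) • τ x B ∂μ‖ ≤ _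
    refine (norm_integral_le_integral_norm _).trans_eq ?_
    simp_rw [norm_smul, τ.norm_act, Complex.norm_real, Real.norm_eq_abs]
    rw [integral_mul_const]

theorem chargeL_apply (hf : IsCutoff f) {R : ℝ} (hR : 0 < R) (B : 𝔄) :
    chargeL τ μ hf hR B = charge τ μ f B R := rfl

theorem act_charge {α : StarAction ℝ 𝔄} (hατ : α.Commutes τ) (hf : IsCutoff f) {R : ℝ}
    (hR : 0 < R) (t : ℝ) (B : 𝔄) : α t (charge τ μ f B R) = charge τ μ f (α t B) R := by
  rw [← α.actL_apply, map_charge hf _ B hR]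
  simp only [α.actL_apply, hατ _ _ _, charge]

theorem hasDerivAt_act_charge {α : StarAction ℝ 𝔄} (hατ : α.Commutes τ) (hf : IsCutoff f) {R : ℝ}
    (hR : 0 < R) {q dq : 𝔄} (hdq : HasDerivAt (fun t : ℝ => α t q) dq 0) :
    HasDerivAt (fun t : ℝ => α t (charge τ μ f q R)) (charge τ μ f dq R) 0 := by
  simp_rw [act_charge hατ hf hR, ← chargeL_apply (τ := τ) (μ := μ) hf hR]
  exact ((chargeL τ μ hf hR).restrictScalars ℝ).hasFDerivAt.comp_hasDerivAt 0 hdq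

theorem map_lie_charge (hf : IsCutoff f) (B C : 𝔄) {R : ℝ} (hR : 0 < R) :
    ω ⁅charge τ μ f B R, C⁆ = ∫ x : Γ, ((f (‖x‖ / R) : ℝ) : ℂ) * ω ⁅τ x B, C⁆ ∂μ := by
  rw [← commFunctional_apply, map_charge hf _ B hR]
  simp only [commFunctional_apply, smul_eq_mul]

theorem map_lie_charge_right (hf : IsCutoff f) (B C : 𝔄) {R : ℝ} (hR : 0 < R) :
    ω ⁅B, charge τ μ f C R⁆ = ∫ x : Γ, ((f (‖x‖ / R) : ℝ) : ℂ) * ω ⁅B, τ x C⁆ ∂μ := by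
  simp_rw [map_lie_skew ω B, map_lie_charge hf C B hR, mul_neg]
  rw [integral_neg]

theorem map_lie_charge_act (hωτ : ∀ (x : Γ) (B : 𝔄), ω (τ x B) = ω B) (hf : IsCutoff f)
    (B C : 𝔄) (y : Γ) {R : ℝ} (hR : 0 < R) :
    ω ⁅charge τ μ f B R, τ y C⁆ =
      ∫ x : Γ, ((f (‖x‖ / R) : ℝ) : ℂ) * ω ⁅τ (x - y) B, C⁆ ∂μ := by
  rw [map_lie_charge hf _ _ hR]
  simp_rw [map_lie_act hωτ]

/-- Translation invariance makes the kernel a function of the difference, the form required by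
`IsCutoff.norm_double_integral_le`. -/
theorem map_lie_charge_charge (hωτ : ∀ (x : Γ) (B : 𝔄), ω (τ x B) = ω B) (hf : IsCutoff f)
    (B C : 𝔄) {R : ℝ} (hR : 0 < R) :
    ω ⁅charge τ μ f B R, charge τ μ f C R⁆ =
      ∫ p : Γ × Γ, ((f (‖p.1‖ / R) * f (‖p.2‖ / R) : ℝ) : ℂ) * ω ⁅τ (p.1 - p.2) B, C⁆
        ∂(μ.prod μ) := by
  have hc := hf.continuous_norm_div (Γ := Γ) R
  have hi : Integrable (fun p : Γ × Γ => ((f (‖p.1‖ / R) * f (‖p.2‖ / R) : ℝ) : ℂ) *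
      ω ⁅τ (p.1 - p.2) B, C⁆) (μ.prod μ) := by
    refine Continuous.integrable_of_hasCompactSupport ?_ ?_
    · exact (Complex.continuous_ofReal.comp ((hc.comp continuous_fst).mul
        (hc.comp continuous_snd))).mul ((continuous_map_lie_act τ ω B C).comp continuous_sub)
    · refine HasCompactSupport.intro ((isCompact_closedBall (0 : Γ) (2 * R)).prod
        (isCompact_closedBall (0 : Γ) (2 * R))) fun p hp => ?_
      have hz : ∀ z : Γ, z ∉ Metric.closedBall (0 : Γ) (2 * R) → f (‖z‖ / R) = 0 := fun z hz => by
        refine hf.eq_zero _ ?_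
        rw [le_div_iff₀ hR]
        exact (not_le.1 fun h => hz (by simpa using h)).le
      by_cases h1 : p.1 ∈ Metric.closedBall (0 : Γ) (2 * R)
      · rw [hz p.2 fun h2 => hp ⟨h1, h2⟩]
        simp
      · rw [hz p.1 h1]
        simp
  rw [integral_prod _ hi, map_lie_charge hf _ _ hR]
  congr 1 with x
  rw [map_lie_charge_right hf _ _ hR, ← integral_const_mul]
  congr 1 with y
  rw [map_lie_act hωτ]
  push_cast
  ring

theorem norm_map_lie_charge_act_sub_le (hωτ : ∀ (x : Γ) (B : 𝔄), ω (τ x B) = ω B)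
    (hf : IsCutoff f) {L : ℝ} (hL : 0 ≤ L) (hLip : ∀ s t, |f s - f t| ≤ L * |s - t|) {q C : 𝔄}
    (h : Integrable (fun x : Γ => ω ⁅τ x q, C⁆) μ) {R : ℝ} (hR : 0 < R) {y : Γ} (hy : ‖y‖ ≤ R) :
    ‖ω ⁅charge τ μ f q R, τ y C⁆ - ∫ x, ω ⁅τ x q, C⁆ ∂μ‖ ≤
      ∫ x, min (2 + L) (L / R * ‖x‖) * ‖ω ⁅τ x q, C⁆‖ ∂μ := by
  rw [map_lie_charge_act hωτ hf _ _ _ hR]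
  exact hf.norm_integral_sub_le hL hLip h hR hy

theorem tendsto_map_lie_charge (hωτ : ∀ (x : Γ) (B : 𝔄), ω (τ x B) = ω B)
    (hf : IsCutoff f) {q C : 𝔄} (h : Integrable (fun x : Γ => ω ⁅τ x q, C⁆) μ) :
    Tendsto (fun R : ℝ => ω ⁅charge τ μ f q R, C⁆) atTop (𝓝 (∫ x, ω ⁅τ x q, C⁆ ∂μ)) := by
  obtain ⟨L, hL, hLip⟩ := hf.exists_lipschitz
  rw [tendsto_iff_norm_sub_tendsto_zero]
  refine squeeze_zero' (Eventually.of_forall fun _ => norm_nonneg _) ?_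
    (tendsto_integral_min_mul hL h)
  filter_upwards [eventually_gt_atTop 0] with R hR
  have := norm_map_lie_charge_act_sub_le hωτ hf hL hLip h hR (y := 0) (by simpa using hR.le)
  rwa [τ.act_zero] at this

theorem integrableOn_act (τ : StarAction Γ 𝔄) (A : 𝔄) (R : ℝ) :
    IntegrableOn (fun x : Γ => τ x A) {x : Γ | ‖x‖ ≤ R} μ := by
  rw [setOf_norm_le_eq_closedBall]
  exact (τ.continuous_orbit A).continuousOn.integrableOn_compact (isCompact_closedBall _ _)

theorem map_bulk (T : 𝔄 →L[ℂ] ℂ) (A : 𝔄) (R : ℝ) :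
    T (bulk τ μ A R) = ∫ x in {x : Γ | ‖x‖ ≤ R}, T (τ x A) ∂μ :=
  (T.integral_comp_comm (integrableOn_act τ A R)).symm

/-- The charge acts on spatial means as on the local observable. -/
theorem tendsto_map_lie_charge_bulkMean (hωτ : ∀ (x : Γ) (B : 𝔄), ω (τ x B) = ω B)
    (hf : IsCutoff f) {q A : 𝔄} (h : Integrable (fun x : Γ => ω ⁅τ x q, A⁆) μ)
    (hV : ∀ᶠ R : ℝ in atTop, 0 < ballVolume μ R) :
    Tendsto (fun R : ℝ => ω ⁅charge τ μ f q R, bulkMean τ μ A R⁆) atTop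
      (𝓝 (∫ x, ω ⁅τ x q, A⁆ ∂μ)) := by
  obtain ⟨L, hL, hLip⟩ := hf.exists_lipschitz
  rw [tendsto_iff_norm_sub_tendsto_zero]
  refine squeeze_zero' (Eventually.of_forall fun _ => norm_nonneg _) ?_
    (tendsto_integral_min_mul hL h)
  filter_upwards [eventually_gt_atTop 0, hV] with R hR hVR
  set c := ∫ x, ω ⁅τ x q, A⁆ ∂μ with hc
  set X := charge τ μ f q R with hX
  set S : Set Γ := {x : Γ | ‖x‖ ≤ R} with hS
  have hSf : μ S ≠ ⊤ := by
    rw [hS, setOf_norm_le_eq_closedBall]; exact measure_closedBall_lt_top.ne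
  have e1 : ω ⁅X, bulk τ μ A R⁆ = ∫ y in S, ω ⁅X, τ y A⁆ ∂μ := by
    have h1 : ∀ Y : 𝔄, ω ⁅X, Y⁆ = -commFunctional ω X Y := fun Y => by
      rw [commFunctional_apply, map_lie_skew]
    simp_rw [h1]
    rw [map_bulk, integral_neg]
  have hint : IntegrableOn (fun y : Γ => ω ⁅X, τ y A⁆) S μ := by
    have h1 : (fun y : Γ => ω ⁅X, τ y A⁆) = fun y => -commFunctional ω X (τ y A) := by
      ext y
      rw [commFunctional_apply, map_lie_skew]
    rw [h1]
    exact ((commFunctional ω X).integrable_comp (integrableOn_act τ A R)).neg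
  have e2 : ω ⁅X, bulk τ μ A R⁆ - ballVolume μ R * c = ∫ y in S, (ω ⁅X, τ y A⁆ - c) ∂μ := by
    rw [integral_sub hint (integrableOn_const hSf), ← e1, setIntegral_const, Complex.real_smul]
    rfl
  have e3 := norm_setIntegral_le_of_norm_le_const (μ := μ) (s := S) hSf.lt_top
    (f := fun y => ω ⁅X, τ y A⁆ - c)
    (C := ∫ x, min (2 + L) (L / R * ‖x‖) * ‖ω ⁅τ x q, A⁆‖ ∂μ)
    fun y hy => norm_map_lie_charge_act_sub_le hωτ hf hL hLip h hR hy
  rw [← e2] at e3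
  have e4 : ω ⁅X, bulkMean τ μ A R⁆ - c =
      (((ballVolume μ R)⁻¹ : ℝ) : ℂ) * (ω ⁅X, bulk τ μ A R⁆ - ballVolume μ R * c) := by
    have h1 : ((ballVolume μ R : ℝ) : ℂ) ≠ 0 := Complex.ofReal_ne_zero.2 hVR.ne'
    rw [bulkMean, Ring.lie_def, mul_smul_comm, smul_mul_assoc, ← smul_sub, ← Ring.lie_def,
      map_smul, smul_eq_mul, mul_sub]
    congr 1
    rw [Complex.ofReal_inv, inv_mul_cancel_left₀ h1]
  rw [e4, norm_mul, Complex.norm_real, Real.norm_of_nonneg (inv_nonneg.2 hVR.le),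
    inv_mul_le_iff₀ hVR, mul_comm (ballVolume μ R)]
  exact e3

end Charges

/-! ### The double commutator is a boundary term. -/

section DoubleCommutator

variable {n : ℕ} {Γ : AddSubgroup (EuclideanSpace ℝ (Fin n))} {μ : Measure Γ} {𝔄 : Type*}
  [CStarAlgebra 𝔄] {τ : StarAction Γ 𝔄} {α : StarAction ℝ 𝔄} {f : ℝ → ℝ} {ω : 𝔄 →L[ℂ] ℂ}

/-- Stationarity makes the correlation of a density with its time derivative even. -/
theorem map_lie_deriv_even (hατ : α.Commutes τ) (hstat : ∀ (t : ℝ) (B : 𝔄), ω (α t B) = ω B)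
    (hωτ : ∀ (x : Γ) (B : 𝔄), ω (τ x B) = ω B) {q dq : 𝔄}
    (hdq : HasDerivAt (fun t : ℝ => α t q) dq 0) (x : Γ) :
    ω ⁅τ (-x) q, dq⁆ = ω ⁅τ x q, dq⁆ := by
  have h1 : HasDerivAt (fun t : ℝ => α t (τ x q)) (τ x dq) 0 := by
    have e : (fun t : ℝ => α t (τ x q)) = fun t => τ.actL x (α t q) :=
      funext fun t => hατ t x q
    rw [e]
    exact ((τ.actL x).restrictScalars ℝ).hasFDerivAt.comp_hasDerivAt 0 hdq
  -- Differentiate ω([α_t q(x), α_t q]), constant by stationarity: the two terms of the product rule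
  -- cancel, and translation invariance rewrites one of them at -x.
  have h2 := (h1.mul hdq).sub (hdq.mul h1)
  have h3 := (ω.restrictScalars ℝ).hasFDerivAt.comp_hasDerivAt 0 h2
  have e : (fun t : ℝ => ω (α t (τ x q) * α t q - α t q * α t (τ x q))) =
      fun _ => ω ⁅τ x q, q⁆ := by
    ext t
    rw [← map_mul, ← map_mul, ← map_sub, hstat, Ring.lie_def]
  have h4 : HasDerivAt (fun t : ℝ => ω (α t (τ x q) * α t q - α t q * α t (τ x q)))
      (ω (τ x dq * α 0 q + α 0 (τ x q) * dq - (dq * α 0 (τ x q) + α 0 q * τ x dq))) 0 := h3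
  rw [e] at h4
  have h5 := h4.unique (hasDerivAt_const 0 _)
  simp only [α.act_zero] at h5
  have h6 : ω ⁅q, τ x dq⁆ = ω ⁅τ (-x) q, dq⁆ := by
    have := map_lie_act hωτ q dq 0 x
    rwa [τ.act_zero, zero_sub] at this
  rw [← h6, Ring.lie_def, Ring.lie_def]
  simp only [map_add, map_sub] at h5 ⊢
  linear_combination -h5

/-- The symmetry has no first-order effect on the mean of a time derivative. -/
theorem map_eq_zero_of_hasDerivAt {σ : StarAction ℝ 𝔄} (hσα : σ.Commutes α)
    (hstat : ∀ (t : ℝ) (B : 𝔄), ω (α t B) = ω B) {q dq D : 𝔄}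
    (hdq : HasDerivAt (fun t : ℝ => α t q) dq 0)
    (hD : HasDerivAt (fun s : ℝ => σ s dq) D 0) : ω D = 0 := by
  -- As `σ` commutes with time, ω ∘ σ_s is again stationary, hence kills time derivatives.
  have h1 : ∀ s : ℝ, ω (σ s dq) = 0 := by
    intro s
    have h2 := ((ω.comp (σ.actL s)).restrictScalars ℝ).hasFDerivAt.comp_hasDerivAt 0 hdq
    have h3 : HasDerivAt (fun t : ℝ => ω (σ s (α t q))) (ω (σ s dq)) 0 := h2
    have e : (fun t : ℝ => ω (σ s (α t q))) = fun _ => ω (σ s q) := by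
      ext t
      rw [hσα, hstat]
    rw [e] at h3
    exact h3.unique (hasDerivAt_const 0 _)
  have h4 : HasDerivAt (fun s : ℝ => ω (σ s dq)) (ω D) 0 :=
    (ω.restrictScalars ℝ).hasFDerivAt.comp_hasDerivAt 0 hD
  simp_rw [h1] at h4
  exact h4.unique (hasDerivAt_const 0 _)

variable [ProperSpace Γ] [μ.IsAddHaarMeasure]

theorem hamiltonianComm_charge (hατ : α.Commutes τ) (hf : IsCutoff f) {R : ℝ} (hR : 0 < R)
    {q dq : 𝔄} (hdq : HasDerivAt (fun t : ℝ => α t q) dq 0) :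
    hamiltonianComm α (charge τ μ f q R) = (-Complex.I) • charge τ μ f dq R := by
  rw [hamiltonianComm, (hasDerivAt_act_charge hατ hf hR hdq).deriv]

/-- The limit of ω([Q_R, dq]) is computed twice: as the full integral, and through the generator of
the symmetry, whose mean at `dq` is zero. -/
theorem integral_map_lie_deriv_eq_zero {σ : StarAction ℝ 𝔄} (hσα : σ.Commutes α)
    (hstat : ∀ (t : ℝ) (B : 𝔄), ω (α t B) = ω B) (hωτ : ∀ (x : Γ) (B : 𝔄), ω (τ x B) = ω B)
    (hf : IsCutoff f) {q dq : 𝔄} (hdq : HasDerivAt (fun t : ℝ => α t q) dq 0)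
    (hσ : GeneratedBy σ τ μ f q dq) (hi : Integrable (fun x : Γ => ω ⁅τ x q, dq⁆) μ) :
    ∫ x : Γ, ω ⁅τ x q, dq⁆ ∂μ = 0 := by
  obtain ⟨D, hD, hlim⟩ := hσ
  have h1 := ((ω.continuous.tendsto D).comp hlim)
  rw [map_eq_zero_of_hasDerivAt hσα hstat hdq hD] at h1
  have h2 := (tendsto_map_lie_charge hωτ hf hi).const_mul Complex.I
  have e : (ω ∘ fun R : ℝ => Complex.I • ⁅charge τ μ f q R, dq⁆) =
      fun R => Complex.I * ω ⁅charge τ μ f q R, dq⁆ := by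
    ext R
    simp
  rw [e] at h1
  simpa using tendsto_nhds_unique h2 h1

/-- The double commutator of the charge with the Hamiltonian is a boundary term. -/
theorem exists_norm_double_commutator_le {σ : StarAction ℝ 𝔄} (hσα : σ.Commutes α)
    (hατ : α.Commutes τ) (hstat : ∀ (t : ℝ) (B : 𝔄), ω (α t B) = ω B)
    (hωτ : ∀ (x : Γ) (B : 𝔄), ω (τ x B) = ω B) (hf : IsCutoff f) {q dq : 𝔄}
    (hdq : HasDerivAt (fun t : ℝ => α t q) dq 0)
    (hdq_short : Integrable (fun x : Γ => (1 + ‖x‖ ^ 2) * ‖⁅τ x q, dq⁆‖) μ)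
    (hσ : GeneratedBy σ τ μ f q dq) :
    ∃ C : ℝ, 0 < C ∧ ∀ R : ℝ, 1 ≤ R →
      ‖ω ⁅charge τ μ f q R, hamiltonianComm α (charge τ μ f q R)⁆‖ * R ^ 2 ≤ C * R ^ n := by
  obtain ⟨L, hL, hLip⟩ := hf.exists_lipschitz
  obtain ⟨C, hC, hV⟩ := ballVolume_le_pow (μ := μ)
  set g : Γ → ℂ := fun x => ω ⁅τ x q, dq⁆ with hg
  have hcc := continuous_lie_act τ q dq
  have i1 : Integrable (fun x : Γ => ‖⁅τ x q, dq⁆‖) μ := by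
    refine hdq_short.mono' hcc.norm.aestronglyMeasurable (Eventually.of_forall fun x => ?_)
    rw [norm_norm]
    exact le_mul_of_one_le_left (norm_nonneg _) (by simp)
  have ig : Integrable g μ := integrable_map_lie i1
  have ig2 : Integrable (fun x => ‖x‖ ^ 2 * ‖g x‖) μ := by
    refine (hdq_short.const_mul ‖ω‖).mono' ?_ (Eventually.of_forall fun x => ?_)
    · exact (Continuous.mul (by fun_prop)
        (continuous_map_lie_act τ ω q dq).norm).aestronglyMeasurable
    · rw [Real.norm_of_nonneg (by positivity)]
      calc ‖x‖ ^ 2 * ‖g x‖ ≤ (1 + ‖x‖ ^ 2) * (‖ω‖ * ‖⁅τ x q, dq⁆‖) := by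
            gcongr
            · linarith
            · exact ω.le_opNorm _
        _ = _ := by ring
  have heven : ∀ x, g (-x) = g x := map_lie_deriv_even hατ hstat hωτ hdq
  have hzero := integral_map_lie_deriv_eq_zero hσα hstat hωτ hf hdq hσ ig
  set m := ∫ x, ‖x‖ ^ 2 * ‖g x‖ ∂μ with hm
  have hm0 : 0 ≤ m := integral_nonneg fun x => by positivity
  -- The summand 1 only makes the constant strictly positive.
  refine ⟨L ^ 2 * (C * 2 ^ n * m) + 1, by positivity, fun R hR => ?_⟩
  have hR0 : 0 < R := by linarith
  have h1 := hf.norm_double_integral_le hL hLip ig ig2 heven hzero hR0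
  rw [← map_lie_charge_charge hωτ hf q dq hR0] at h1
  have h2 := hV (2 * R) (by linarith)
  rw [hamiltonianComm_charge hατ hf hR0 hdq, Ring.lie_def, mul_smul_comm, smul_mul_assoc,
    ← smul_sub, ← Ring.lie_def, map_smul, norm_smul, norm_neg, Complex.norm_I, one_mul]
  calc _ ≤ (L / R) ^ 2 * (ballVolume μ (2 * R) * m) * R ^ 2 := by gcongr
    _ ≤ (L / R) ^ 2 * (C * (2 * R) ^ n * m) * R ^ 2 := by gcongr
    _ = L ^ 2 * (C * 2 ^ n * m) * R ^ n := by
      rw [mul_pow]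
      field_simp
    _ ≤ _ := by
      gcongr
      linarith

end DoubleCommutator

/-! ### From growth of integrals to slow pointwise decay. -/

section Decay

variable {n : ℕ} {Γ : AddSubgroup (EuclideanSpace ℝ (Fin n))} [ProperSpace Γ] {μ : Measure Γ}
  [μ.IsAddHaarMeasure]

/-- One dyadic shell: its volume is at most C(2R)^n and the bound on φ there is of order ε R^(2-n),
so doubling the radius adds O(ε R²). -/
theorem setIntegral_norm_le_two_mul_le {φ : Γ → ℝ} (hφ : Continuous φ) {C ε r R : ℝ}
    (hV : ∀ R : ℝ, 1 ≤ R → ballVolume μ R ≤ C * R ^ n) (hε : 0 ≤ ε) (hR : 1 ≤ R) (hr : r ≤ R)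
    (h : ∀ x : Γ, r ≤ ‖x‖ → φ x ≤ ε * ‖x‖ ^ (2 - (n : ℤ))) :
    ∫ x in {x : Γ | ‖x‖ ≤ 2 * R}, φ x ∂μ ≤
      (∫ x in {x : Γ | ‖x‖ ≤ R}, φ x ∂μ) + C * 2 ^ (n + 1) * ε * R ^ 2 := by
  have hR0 : 0 < R := by linarith
  have hm : ∀ ρ : ℝ, MeasurableSet {x : Γ | ‖x‖ ≤ ρ} := fun ρ => by
    rw [setOf_norm_le_eq_closedBall]; exact Metric.isClosed_closedBall.measurableSet
  have hfin : ∀ ρ : ℝ, μ {x : Γ | ‖x‖ ≤ ρ} ≠ ⊤ := fun ρ => by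
    rw [setOf_norm_le_eq_closedBall]; exact measure_closedBall_lt_top.ne
  have hi : ∀ ρ : ℝ, IntegrableOn φ {x : Γ | ‖x‖ ≤ ρ} μ := fun ρ => by
    rw [setOf_norm_le_eq_closedBall]
    exact hφ.continuousOn.integrableOn_compact (isCompact_closedBall _ _)
  set κ : ℝ := ε * (2 * R ^ (2 - (n : ℤ))) with hκ
  have hκ0 : 0 ≤ κ := by positivity
  have i1 : IntegrableOn ({x : Γ | ‖x‖ ≤ R}.indicator φ) {x : Γ | ‖x‖ ≤ 2 * R} μ :=
    (hi _).indicator (hm R)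
  have hsub : {x : Γ | ‖x‖ ≤ 2 * R} ∩ {x : Γ | ‖x‖ ≤ R} = {x : Γ | ‖x‖ ≤ R} :=
    Set.inter_eq_right.2 fun x (hx : ‖x‖ ≤ R) => hx.trans (by linarith)
  calc ∫ x in {x : Γ | ‖x‖ ≤ 2 * R}, φ x ∂μ
      ≤ ∫ x in {x : Γ | ‖x‖ ≤ 2 * R}, ({x : Γ | ‖x‖ ≤ R}.indicator φ x + κ) ∂μ := by
        refine setIntegral_mono_on (hi _) (i1.add (integrableOn_const (hfin _))) (hm _)
          fun x hx => ?_
        by_cases hxR : ‖x‖ ≤ R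
        · rw [Set.indicator_of_mem (show x ∈ {x : Γ | ‖x‖ ≤ R} from hxR)]
          linarith
        · rw [Set.indicator_of_notMem (show x ∉ {x : Γ | ‖x‖ ≤ R} from hxR), zero_add]
          rw [not_le] at hxR
          refine (h x (hr.trans hxR.le)).trans (mul_le_mul_of_nonneg_left ?_ hε)
          have h1 : 1 ≤ ‖x‖ / R := (one_le_div hR0).2 hxR.le
          have h2 : ‖x‖ / R ≤ 2 := (div_le_iff₀ hR0).2 hx
          -- The exponent is at most 1 when n ≥ 1 and the ratio lies in [1, 2]; in dimension 0 the
          -- shell is empty.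
          have h3 : (‖x‖ / R) ^ (2 - (n : ℤ)) ≤ 2 := by
            rcases Nat.eq_zero_or_pos n with hn | hn
            · subst hn
              have : x = 0 := by
                apply Subtype.ext
                exact Subsingleton.elim _ _
              rw [this, norm_zero] at hxR
              linarith
            · calc (‖x‖ / R) ^ (2 - (n : ℤ)) ≤ (‖x‖ / R) ^ (1 : ℤ) :=
                    zpow_le_zpow_right₀ h1 (by omega)
                _ ≤ 2 := by rwa [zpow_one]
          rw [div_zpow, div_le_iff₀ (by positivity)] at h3
          exact h3
    _ = (∫ x in {x : Γ | ‖x‖ ≤ R}, φ x ∂μ) + ballVolume μ (2 * R) * κ := by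
        rw [integral_add i1 (integrableOn_const (hfin _)), setIntegral_indicator (hm R), hsub,
          setIntegral_const]
        rfl
    _ ≤ _ := by
        have h4 : R ^ n * R ^ (2 - (n : ℤ)) = R ^ 2 := by
          rw [← zpow_natCast, ← zpow_add₀ hR0.ne', add_sub_cancel]
          norm_cast
        have h5 : ballVolume μ (2 * R) * κ ≤ C * (2 * R) ^ n * κ := by
          gcongr
          exact hV _ (by linarith)
        have h6 : C * (2 * R) ^ n * κ = C * 2 ^ (n + 1) * ε * R ^ 2 := by
          rw [hκ, ← h4, mul_pow, pow_succ]
          ring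
        linarith

/-- A function whose integral over balls grows at least like `R ^ 2` decays no faster than
`|x| ^ (2 - n)`. -/
theorem exists_slow_decay {φ : Γ → ℝ} (hφ : Continuous φ) {c : ℝ} (hc : 0 < c)
    (h : ∀ᶠ R : ℝ in atTop, c * R ^ 2 ≤ ∫ x in {x : Γ | ‖x‖ ≤ 2 * R}, φ x ∂μ) :
    ∃ ε : ℝ, 0 < ε ∧ ∀ r : ℝ, ∃ x : Γ, r ≤ ‖x‖ ∧ ε * ‖x‖ ^ (2 - (n : ℤ)) ≤ φ x := by
  obtain ⟨C, hC, hV⟩ := ballVolume_le_pow (μ := μ)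
  set K := C * 2 ^ (n + 1) with hK
  have hK0 : 0 < K := by positivity
  refine ⟨c / (2 * K), by positivity, ?_⟩
  by_contra! hcon
  obtain ⟨r, hr⟩ := hcon
  set r₀ := max r 1 with hr₀
  have hr1 : 1 ≤ r₀ := le_max_right _ _
  set T : ℝ → ℝ := fun R => ∫ x in {x : Γ | ‖x‖ ≤ R}, φ x ∂μ with hT
  have hge : ∀ k : ℕ, r₀ ≤ 2 ^ k * r₀ := fun k =>
    le_mul_of_one_le_left (by linarith) (one_le_pow₀ one_le_two)
  have hstep : ∀ k : ℕ, T (2 * (2 ^ k * r₀)) ≤ T (2 ^ k * r₀) + c / 2 * (2 ^ k * r₀) ^ 2 := by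
    intro k
    have h1 := setIntegral_norm_le_two_mul_le (μ := μ) hφ hV (ε := c / (2 * K)) (by positivity)
      (hr1.trans (hge k)) ((le_max_left _ _).trans (hge k)) fun x hx => (hr x hx).le
    have h2 : C * 2 ^ (n + 1) * (c / (2 * K)) = c / 2 := by
      rw [← hK]
      field_simp
    rwa [h2] at h1
  -- The constant c/6 reproduces itself under doubling: c/6 + c/2 = 4 · c/6. One further doubling
  -- yields at most T r₀ + (2c/3)ρ², against the lower bound cρ².
  have hind : ∀ k : ℕ, T (2 ^ k * r₀) ≤ T r₀ + c / 6 * (2 ^ k * r₀) ^ 2 := by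
    intro k
    induction k with
    | zero =>
      simp only [pow_zero, one_mul]
      nlinarith [sq_nonneg r₀]
    | succ k ih =>
      have h1 := hstep k
      have h2 : (2 : ℝ) ^ (k + 1) * r₀ = 2 * (2 ^ k * r₀) := by ring
      rw [h2]
      linarith
  have htend : Tendsto (fun k : ℕ => (2 : ℝ) ^ k * r₀) atTop atTop :=
    (tendsto_pow_atTop_atTop_of_one_lt one_lt_two).atTop_mul_const (by linarith)
  have hsq : Tendsto (fun k : ℕ => c / 3 * ((2 : ℝ) ^ k * r₀) ^ 2) atTop atTop :=
    ((tendsto_pow_atTop two_ne_zero).comp htend).const_mul_atTop (by positivity)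
  obtain ⟨k, hk1, hk2⟩ := ((htend.eventually h).and (hsq.eventually_gt_atTop (T r₀))).exists
  have h3 : c * (2 ^ k * r₀) ^ 2 ≤ T (2 * (2 ^ k * r₀)) := hk1
  have h4 := hstep k
  have h5 := hind k
  linarith

end Decay

/-! ### Fluctuations, the two-point function and locality. -/

section Fluctuations

variable {n : ℕ} {Γ : AddSubgroup (EuclideanSpace ℝ (Fin n))} {μ : Measure Γ}
  {𝔄 : Type*} [CStarAlgebra 𝔄] {τ : StarAction Γ 𝔄} {ω : 𝔄 →L[ℂ] ℂ}

theorem map_bulkMean_mul_bulkMean (A : 𝔄) (R : ℝ) :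
    (ω (bulkMean τ μ A R * bulkMean τ μ A R)).re =
      ((ballVolume μ R)⁻¹) ^ 2 * (ω (bulk τ μ A R * bulk τ μ A R)).re := by
  rw [bulkMean, smul_mul_smul_comm, map_smul, smul_eq_mul, ← Complex.ofReal_mul,
    Complex.re_ofReal_mul, sq]

variable [ProperSpace Γ] [μ.IsAddHaarMeasure]

/-- By invariance the integrand depends on x - y only, and differences of points of the ball have
norm at most 2R; the remaining variable contributes the volume. -/
theorem norm_map_bulk_mul_bulk_le (hωτ : ∀ (x : Γ) (B : 𝔄), ω (τ x B) = ω B) (A : 𝔄) (R : ℝ) :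
    ‖ω (bulk τ μ A R * bulk τ μ A R)‖ ≤
      ballVolume μ R * ∫ x in {x : Γ | ‖x‖ ≤ 2 * R}, ‖ω (τ x A * A)‖ ∂μ := by
  have hm : ∀ ρ : ℝ, MeasurableSet {x : Γ | ‖x‖ ≤ ρ} := fun ρ => by
    rw [setOf_norm_le_eq_closedBall]; exact Metric.isClosed_closedBall.measurableSet
  have hfin : μ {x : Γ | ‖x‖ ≤ R} < ⊤ := by
    rw [setOf_norm_le_eq_closedBall]; exact measure_closedBall_lt_top
  set φ : Γ → ℝ := fun x => ‖ω (τ x A * A)‖ with hφ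
  have hφc : Continuous φ :=
    (ω.continuous.comp ((τ.continuous_orbit A).mul_const A)).norm
  have hi : ∀ ρ : ℝ, IntegrableOn φ {x : Γ | ‖x‖ ≤ ρ} μ := fun ρ => by
    rw [setOf_norm_le_eq_closedBall]
    exact hφc.continuousOn.integrableOn_compact (isCompact_closedBall _ _)
  have htr : ∀ x y : Γ, ω (τ x A * τ y A) = ω (τ (x - y) A * A) := by
    intro x y
    rw [← hωτ y (τ (x - y) A * A), map_mul (τ y), ← τ.act_add, add_sub_cancel]
  have e1 := map_bulk (μ := μ) (τ := τ) (ω.comp (ContinuousLinearMap.mul ℂ 𝔄 (bulk τ μ A R))) A R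
  simp only [ContinuousLinearMap.comp_apply, ContinuousLinearMap.mul_apply'] at e1
  rw [e1, mul_comm]
  refine norm_setIntegral_le_of_norm_le_const hfin fun y (hy : ‖y‖ ≤ R) => ?_
  have e2 := map_bulk (μ := μ) (τ := τ)
    (ω.comp ((ContinuousLinearMap.mul ℂ 𝔄).flip (τ y A))) A R
  simp only [ContinuousLinearMap.comp_apply, ContinuousLinearMap.flip_apply,
    ContinuousLinearMap.mul_apply'] at e2
  rw [e2]
  refine (norm_integral_le_integral_norm _).trans ?_
  simp_rw [htr]
  change ∫ x in {x : Γ | ‖x‖ ≤ R}, φ (x - y) ∂μ ≤ _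
  rw [← integral_indicator (hm R), ← integral_add_right_eq_self _ y, ← integral_indicator (hm _)]
  refine integral_mono_of_nonneg (Eventually.of_forall fun x => ?_)
    ((integrable_indicator_iff (hm _)).2 (hi _)) (Eventually.of_forall fun x => ?_)
  · exact Set.indicator_nonneg (fun _ _ => norm_nonneg _) _
  · by_cases hx : ‖x + y‖ ≤ R
    · have h2 : ‖x‖ ≤ 2 * R := by
        have : x = (x + y) - y := by simp
        rw [this]
        exact (norm_sub_le _ _).trans (by linarith)
      simp only
      rw [Set.indicator_of_mem (show x + y ∈ {x : Γ | ‖x‖ ≤ R} from hx),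
        Set.indicator_of_mem (show x ∈ {x : Γ | ‖x‖ ≤ 2 * R} from h2), add_sub_cancel_right]
    · simp only
      rw [Set.indicator_of_notMem (show x + y ∉ {x : Γ | ‖x‖ ≤ R} from hx)]
      exact Set.indicator_nonneg (fun _ _ => norm_nonneg _) _

/-- Once ‖x‖ exceeds the sum of the two localization radii the regions are disjoint, so the
commutator has compact support in `x`. -/
theorem LocalNet.integrable_lie {N : LocalNet τ} {q A : 𝔄} (hq : q ∈ N.localAlg)
    (hA : A ∈ N.localAlg) : Integrable (fun x : Γ => ‖⁅τ x q, A⁆‖) μ := by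
  obtain ⟨V, hV, hqV⟩ := hq
  obtain ⟨W, hW, hAW⟩ := hA
  obtain ⟨a, ha⟩ := hV.exists_norm_le
  obtain ⟨b, hb⟩ := hW.exists_norm_le
  refine Continuous.integrable_of_hasCompactSupport (continuous_lie_act τ q A).norm
    (HasCompactSupport.intro (isCompact_closedBall (0 : Γ) (a + b)) fun x hx => ?_)
  have hx' : a + b < ‖(x : EuclideanSpace ℝ (Fin n))‖ := by
    by_contra! h
    exact hx (by simpa using h)
  have hdisj : Disjoint ((x : EuclideanSpace ℝ (Fin n)) +ᵥ V) W := by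
    rw [Set.disjoint_left]
    rintro _ ⟨v, hv, rfl⟩ hw
    have h1 := ha v hv
    have h2 := hb _ hw
    have h3 : (x : EuclideanSpace ℝ (Fin n)) = (x + v) - v := by simp
    have h4 := norm_sub_le ((x : EuclideanSpace ℝ (Fin n)) + v) v
    rw [← h3] at h4
    simp only [vadd_eq_add] at h2
    linarith
  have hcomm := N.commute _ _ hdisj _ (N.covariant x V q hqV) A hAW
  rw [norm_eq_zero, Ring.lie_def, hcomm.eq, sub_self]

end Fluctuations

/-! ### Assembly of the four conclusions. -/

theorem mainTheorem5
    -- space dimension, and the group of space translations: all of `ℝⁿ`, a lattice, ...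
    {n : ℕ} (hn : 1 ≤ n)
    (Γ : AddSubgroup (EuclideanSpace ℝ (Fin n)))
    (hΓ_closed : IsClosed (Γ : Set (EuclideanSpace ℝ (Fin n))))
    (hΓ_span : Submodule.span ℝ (Γ : Set (EuclideanSpace ℝ (Fin n))) = ⊤)
    (μ : Measure Γ) [μ.IsAddHaarMeasure]
    -- the quasi-local algebra with its translations and its time evolution
    {𝔄 : Type*} [CStarAlgebra 𝔄]
    (τ : StarAction Γ 𝔄) (N : LocalNet τ) (α : StarAction ℝ 𝔄) (hατ : α.Commutes τ)
    -- a translation invariant temperature state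
    (β : ℝ) (hβ : 0 < β) (ω : 𝔄 →L[ℂ] ℂ) (hω : IsKMS α β ω)
    (hωτ : ∀ (x : Γ) (B : 𝔄), ω (τ x B) = ω B)
    -- a local density `q` with time derivative `dq` of short range
    (f : ℝ → ℝ) (hf : IsCutoff f)
    (q dq : 𝔄) (hq : IsSelfAdjoint q) (hq_loc : q ∈ N.localAlg)
    (hdq : HasDerivAt (fun t : ℝ => α t q) dq 0)
    (hdq_short : Integrable (fun x : Γ => (1 + ‖x‖ ^ 2) * ‖⁅τ x q, dq⁆‖) μ)
    -- the symmetry group generated by `q`; it commutes with the time evolution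
    (σ : StarAction ℝ 𝔄) (hσα : σ.Commutes α)
    (hσ : ∀ B ∈ N.localAlg ∪ {dq}, GeneratedBy σ τ μ f q B)
    -- the symmetry-breaking observable: local or, at least, with integrable commutators
    (A : 𝔄) (hA : IsSelfAdjoint A) (hA_mean : ω A = 0)
    (hA_loc : A ∈ N.localAlg ∨ Integrable (fun x : Γ => ‖⁅τ x q, A⁆‖) μ)
    (hssb : BreaksSymmetry ω τ μ f q A) :
    -- Bogoliubov's inequality
    (∀ R : ℝ, 0 < R →
      DifferentiableAt ℝ (fun t : ℝ => α t (charge τ μ f q R)) 0 ∧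
      ‖ω ⁅charge τ μ f q R, bulkMean τ μ A R⁆‖ ^ 2 ≤
        β * (ω (bulkMean τ μ A R * bulkMean τ μ A R)).re *
          (ω ⁅charge τ μ f q R, hamiltonianComm α (charge τ μ f q R)⁆).re) ∧
    -- the double commutator is of order `R^(n-2)`
    ((fun R : ℝ => (ω ⁅charge τ μ f q R, hamiltonianComm α (charge τ μ f q R)⁆).re)
      =O[atTop] fun R : ℝ => R ^ ((n : ℤ) - 2)) ∧
    -- anomalously large fluctuations
    (∃ c : ℝ, 0 < c ∧ ∀ᶠ R : ℝ in atTop,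
      c * R ^ (n + 2) ≤ (ω (bulk τ μ A R * bulk τ μ A R)).re) ∧
    -- the two-point function decays no faster than `|x|^(2-n)`
    (∃ c : ℝ, 0 < c ∧ ∀ r : ℝ, ∃ x : Γ, r ≤ ‖x‖ ∧
      c * ‖x‖ ^ (2 - (n : ℤ)) ≤ ‖ω (τ x A * A)‖) := by
  have : ProperSpace Γ := AddSubgroup.properSpace_of_isClosed hΓ_closed
  have hbog : ∀ R : ℝ, 0 < R → ‖ω ⁅charge τ μ f q R, bulkMean τ μ A R⁆‖ ^ 2 ≤
      β * (ω (bulkMean τ μ A R * bulkMean τ μ A R)).re *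
        (ω ⁅charge τ μ f q R, hamiltonianComm α (charge τ μ f q R)⁆).re := fun R hR =>
    hω.bogoliubov hβ (isSelfAdjoint_bulkMean hA R) (isSelfAdjoint_charge hq R)
      (hasDerivAt_act_charge hατ hf hR hdq)
  obtain ⟨C, hC, hD⟩ := exists_norm_double_commutator_le hσα hατ hω.stationary hωτ hf hdq hdq_short
    (hσ dq (Or.inr rfl))
  obtain ⟨C', hC', hV'⟩ := ballVolume_le_pow (μ := μ)
  obtain ⟨v, hv, hV⟩ := pow_le_ballVolume (μ := μ) hΓ_span
  have hVpos : ∀ᶠ R : ℝ in atTop, 0 < ballVolume μ R := by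
    filter_upwards [hV, eventually_gt_atTop 0] with R h1 h2
    exact lt_of_lt_of_le (by positivity) h1
  have hAi : Integrable (fun x : Γ => ω ⁅τ x q, A⁆) μ :=
    integrable_map_lie (hA_loc.elim (fun h => N.integrable_lie hq_loc h) id)
  obtain ⟨c, hc, hlim⟩ := hssb
  have hlim' := tendsto_map_lie_charge_bulkMean hωτ hf hAi hVpos
  -- The limits for `A` and for its spatial means are the same integral, so the means inherit the
  -- nonzero constant `c`.
  rw [tendsto_nhds_unique (tendsto_map_lie_charge hωτ hf hAi) hlim] at hlim'
  have hc0 : 0 < ‖c‖ := norm_pos_iff.2 hc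
  have hfluct : ∃ b : ℝ, 0 < b ∧ ∀ᶠ R : ℝ in atTop,
      b * R ^ (n + 2) ≤ (ω (bulk τ μ A R * bulk τ μ A R)).re := by
    -- Eventually the commutator mean has modulus at least ‖c‖/2 and the volume is at least v R^n;
    -- solving Bogoliubov's inequality for the fluctuation gives this constant.
    refine ⟨(‖c‖ / 2) ^ 2 * v ^ 2 / (β * C), by positivity, ?_⟩
    filter_upwards [hV, hVpos, eventually_ge_atTop 1,
      hlim'.norm.eventually_const_le (half_lt_self hc0)] with R h1 h2 hR h3
    have hR0 : 0 < R := by linarith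
    have h4 := hbog R hR0
    have hS : 0 ≤ (ω (bulk τ μ A R * bulk τ μ A R)).re := by
      have := (hω.isState.nonneg (bulk τ μ A R)).1
      rwa [(isSelfAdjoint_bulk hA R).star_eq] at this
    rw [map_bulkMean_mul_bulkMean] at h4
    set S := (ω (bulk τ μ A R * bulk τ μ A R)).re with hSdef
    set V := ballVolume μ R with hVdef
    set d := (ω ⁅charge τ μ f q R, hamiltonianComm α (charge τ μ f q R)⁆).re with hd
    have h5 : d * R ^ 2 ≤ C * R ^ n :=
      (mul_le_mul_of_nonneg_right (Complex.re_le_norm _) (sq_nonneg R)).trans (hD R hR)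
    have h6 : (‖c‖ / 2) ^ 2 ≤ β * (V⁻¹ ^ 2 * S) * d :=
      (pow_le_pow_left₀ (by positivity) h3 2).trans h4
    have h7 : (‖c‖ / 2) ^ 2 * V ^ 2 * R ^ 2 ≤ β * S * (C * R ^ n) := by
      calc (‖c‖ / 2) ^ 2 * V ^ 2 * R ^ 2 ≤ β * (V⁻¹ ^ 2 * S) * d * V ^ 2 * R ^ 2 := by gcongr
        _ = β * S * (d * R ^ 2) := by field_simp
        _ ≤ _ := by gcongr
    have h8 : (‖c‖ / 2) ^ 2 * (v * R ^ n) ^ 2 * R ^ 2 ≤ β * S * (C * R ^ n) :=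
      le_trans (by gcongr) h7
    have hRn : 0 < R ^ n := by positivity
    rw [div_mul_eq_mul_div, div_le_iff₀ (by positivity)]
    refine le_of_mul_le_mul_right (le_trans (le_of_eq ?_) (h8.trans (le_of_eq ?_))) hRn
    · ring
    · ring
  refine ⟨fun R hR => ⟨(hasDerivAt_act_charge hατ hf hR hdq).differentiableAt, hbog R hR⟩, ?_,
    hfluct, ?_⟩
  · refine IsBigO.of_bound C ?_
    filter_upwards [eventually_ge_atTop 1] with R hR
    have hR0 : 0 < R := by linarith
    rw [Real.norm_eq_abs, Real.norm_of_nonneg (by positivity), zpow_sub₀ hR0.ne', zpow_natCast,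
      ← mul_div_assoc, le_div_iff₀ (by positivity)]
    refine le_trans ?_ (hD R hR)
    norm_cast
    gcongr
    exact Complex.abs_re_le_norm _
  · obtain ⟨b, hb, hfl⟩ := hfluct
    -- Dividing b R^(n+2) by the volume bound C' R^n leaves (b/C') R² for the integral over the
    -- doubled ball.
    refine exists_slow_decay (μ := μ) (φ := fun x => ‖ω (τ x A * A)‖)
      (ω.continuous.comp ((τ.continuous_orbit A).mul_const A)).norm (c := b / C') (by positivity) ?_
    filter_upwards [hfl, eventually_ge_atTop 1] with R h1 hR
    have hR0 : 0 < R := by linarith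
    have hT : 0 ≤ ∫ x in {x : Γ | ‖x‖ ≤ 2 * R}, ‖ω (τ x A * A)‖ ∂μ :=
      integral_nonneg fun _ => norm_nonneg _
    have h2 := (h1.trans (Complex.re_le_norm _)).trans (norm_map_bulk_mul_bulk_le hωτ A R)
    have h3 := h2.trans (mul_le_mul_of_nonneg_right (hV' R hR) hT)
    have hRn : 0 < R ^ n := by positivity
    rw [div_mul_eq_mul_div, div_le_iff₀ hC']
    refine le_of_mul_le_mul_right (le_trans (le_of_eq ?_) (h3.trans (le_of_eq ?_))) hRn
    · ring
    · ring
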